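/- Let $d\ge 3$, $W=[0,1]^d$, let $L=\mathbb{R}^2\times\{0\}^{d-2}$, and write $A|_L$ for the orthogonal projection of a set $A$ onto $L$. Let $c>0$ and let $\delta_t>0$ satisfy $t\delta_t^d=c$ for all $t>0$. For every $t>0$ let $V_t$ be the (random, finite) set of points of a Poisson point process on $W$ with intensity $t$ (intensity measure $t$ times Lebesgue measure on $W$). Join two points of $V_t$ by an edge if their Euclidean distance is at most $\delta_t$, and let $$\xi_t(W_L)=\frac18\,\#\{(v_1,v_2,w_1,w_2)\in (V_t)^4_{\neq}:\ \|v_1-v_2\|\le\delta_t,\ \|w_1-w_2\|\le\delta_t,\ [v_1,v_2]|_L\cap[w_1,w_2]|_L\cap W_L\neq\emptyset\}$$ be the number of edge crossings in the projection onto $L$, where $W_L=W|_L$ and $(V_t)^k_{\neq}$ is the set of $k$-tuples of pairwise distinct points. Let $w,d_0,d_1:\mathbb{R}^d\times\mathbb{R}^d\to\mathbb{R}$ be measurable (a weight and two distance functions; the axioms of a metric are not needed), with $w\ge 0$ on $W\times W$, put $S(x,y)=w(x,y)\,(d_0(x,y)-d_1(x,y))^2$, assume that $S<s$ on $W\times W$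 for some constant $s>0$, and let $$\mathrm{stress}_t=\frac12\sum_{(v_1,v_2)\in (V_t)^2_{\neq}}S(v_1,v_2),\qquad S^{(1)}_{W,L}(v)=\int_{W-v}S(v,v+u)\,du .$$ (If $w,d_0,d_1$ are translation invariant, then $S(v,v+u)=S(0,u)$.) Then $\xi_t(W_L)$ and $\mathrm{stress}_t$ are square integrable for all $t>0$, and $$\mathrm{Cov}\big(\xi_t(W_L),\mathrm{stress}_t\big)=\frac12\,c_d\,c^2\,t^3\delta_t^2\int_W S^{(1)}_{W,L}(v)\,dv\;\big(1+\mathcal{O}(\delta_t)\big)\qquad\text{as }t\to\infty,$$ where the implied constant may depend on $d,c,w,d_0,d_1$ and $$c_d=\int_{2B_2}\int_{(B_d)^2}\mathbf 1\{[0,w_1]|_L\cap(w_3+[0,w_2]|_L)\ne\emptyset\}\,dw_1\,dw_2\,dw_3 = 2\pi\,\kappa_{d-2}^2\,\mathbf{B}\big(\tfrac32,\tfrac d2\big)^2 ,$$ with $2B_2$ the disc of radius $2$ around the origin in $L$, $B_d$ the unit ball of $\mathbb{R}^d$, $\kappa_{n}$ the volume of the unit ball of $\mathbb{R}^{n}$,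 and $\mathbf{B}$ the beta function. -/

import Mathlib

open MeasureTheory ProbabilityTheory Filter Asymptotics

noncomputable section

/-- The cube `[0,1]^d` in Euclidean space. -/
def unitCube (d : ℕ) : Set (EuclideanSpace ℝ (Fin d)) :=
  {x | ∀ i, x i ∈ Set.Icc (0 : ℝ) 1}

/-- The coordinate plane `ℝ² × {0}^(d-2)` in Euclidean space (for `d ≥ 2`). -/
def coordPlane (d : ℕ) : Submodule ℝ (EuclideanSpace ℝ (Fin d)) where
  carrier := {x | ∀ i : Fin d, 2 ≤ (i : ℕ) → x i = 0}
  add_mem' := by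
    intro a b ha hb i hi
    simp [ha i hi, hb i hi]
  zero_mem' := by
    intro i _
    simp
  smul_mem' := by
    intro r a ha i hi
    simp [ha i hi]

/-- The orthogonal projection onto the coordinate plane, as a map from the space to itself. -/
def planeProj (d : ℕ) (x : EuclideanSpace ℝ (Fin d)) : EuclideanSpace ℝ (Fin d) :=
  (coordPlane d).starProjection x

/-- A Poisson point process with finite, diffuse intensity measure `Λ`, given as a random finite
set `V`: the numbers of points in measurable sets are random variables, the number of points in
`A` is Poisson distributed with parameter `Λ A`, and the numbers of points in pairwise disjoint
sets are independent. -/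
structure IsPoissonProcess {Ω X : Type*} [MeasurableSpace Ω] [MeasurableSpace X]
    (P : Measure Ω) (Λ : Measure X) (V : Ω → Finset X) : Prop where
  measurable_count : ∀ A : Set X, MeasurableSet A →
    Measurable fun ω => ((V ω : Set X) ∩ A).ncard
  law_count : ∀ A : Set X, MeasurableSet A →
    P.map (fun ω => ((V ω : Set X) ∩ A).ncard) = poissonMeasure (Λ A).toNNReal
  indep_count : ∀ (n : ℕ) (A : Fin n → Set X), (∀ i, MeasurableSet (A i)) →
    (∀ i j, i ≠ j → Disjoint (A i) (A j)) →
    iIndepFun (fun i ω => ((V ω : Set X) ∩ A i).ncard) P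

open Classical in
/-- The sum of `f` over all ordered `k`-tuples of pairwise distinct elements of `V`. -/
def sumDistinct {X : Type*} (k : ℕ) (f : (Fin k → X) → ℝ) (V : Finset X) : ℝ :=
  ∑ x ∈ (Fintype.piFinset fun _ : Fin k => V) with Function.Injective x, f x

/-- The quadruples `(v₁, v₂, w₁, w₂)` such that `{v₁, v₂}` and `{w₁, w₂}` have length at most `r`
and their projections to the plane intersect inside `A`. -/
def crossingQuadruples (d : ℕ) (r : ℝ) (A : Set (EuclideanSpace ℝ (Fin d))) :
    Set (Fin 4 → EuclideanSpace ℝ (Fin d)) :=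
  {x | ‖x 0 - x 1‖ ≤ r ∧ ‖x 2 - x 3‖ ≤ r ∧
    ((planeProj d '' segment ℝ (x 0) (x 1)) ∩ (planeProj d '' segment ℝ (x 2) (x 3)) ∩ A).Nonempty}

/-- The number of crossings inside `A` of the projected geometric graph with vertex set `V` and
edges between vertices at distance at most `r`. Every crossing pair of edges corresponds to
eight ordered quadruples. -/
def crossingNumber (d : ℕ) (r : ℝ) (A : Set (EuclideanSpace ℝ (Fin d)))
    (V : Finset (EuclideanSpace ℝ (Fin d))) : ℝ :=
  (1 / 8) * sumDistinct 4 ((crossingQuadruples d r A).indicator fun _ => 1) V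

/-- The stress `w (d₀ - d₁)²` between two points. -/
def pairStress {X : Type*} (w d₀ d₁ : X → X → ℝ) (x y : X) : ℝ :=
  w x y * (d₀ x y - d₁ x y) ^ 2

/-- The stress of a drawing with vertex set `V`. -/
def stress {X : Type*} (w d₀ d₁ : X → X → ℝ) (V : Finset X) : ℝ :=
  (1 / 2) * sumDistinct 2 (fun x => pairStress w d₀ d₁ (x 0) (x 1)) V

/-- The integrated pairwise stress around the point `v`: the integral over `u ∈ W - v` of the
stress between `v` and `v + u`. For translation invariant `w`, `d₀`, `d₁` the latter is the stress
between `0` and `u`. -/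
def integratedStress {d : ℕ} (W : Set (EuclideanSpace ℝ (Fin d)))
    (w d₀ d₁ : EuclideanSpace ℝ (Fin d) → EuclideanSpace ℝ (Fin d) → ℝ)
    (v : EuclideanSpace ℝ (Fin d)) : ℝ :=
  ∫ u in (fun x => x - v) '' W, pairStress w d₀ d₁ v (v + u)

open Classical in
/-- The constant `c_d`: the measure of all `(w₃, w₁, w₂)`, with `w₃` in the disc of radius `2` in
the plane (with its two-dimensional Lebesgue measure) and `w₁, w₂` in the `d`-dimensional unit
ball, such that the projected segments `[0, w₁]` and `w₃ + [0, w₂]` intersect. -/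
def crossingConst (d : ℕ) : ℝ :=
  ∫ w₃ in Metric.closedBall (0 : coordPlane d) 2,
    ∫ w₁ in Metric.closedBall (0 : EuclideanSpace ℝ (Fin d)) 1,
      ∫ w₂ in Metric.closedBall (0 : EuclideanSpace ℝ (Fin d)) 1,
        if ((planeProj d '' segment ℝ 0 w₁) ∩
          ((fun x => (w₃ : EuclideanSpace ℝ (Fin d)) + x) '' (planeProj d '' segment ℝ 0 w₂))
          ).Nonempty then (1 : ℝ) else 0

/-- The volume of the `n`-dimensional Euclidean unit ball. -/
def unitBallVolume (n : ℕ) : ℝ :=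
  volume.real (Metric.closedBall (0 : EuclideanSpace ℝ (Fin n)) 1)

end

set_option linter.unusedSectionVars false

section Moments
open scoped NNReal ENNReal

lemma lintegral_natCast_poissonMeasure (r : ℝ≥0) :
    ∫⁻ n, (n : ℝ≥0∞) ∂(poissonMeasure r) = r := by
  have hr : (r : ℝ≥0∞) = ENNReal.ofReal (r * 1) := by simp
  rw [poissonMeasure, lintegral_sum_measure, hr,
    ← ((hasSum_one_poissonMeasure r).mul_left (r : ℝ)).tsum_eq,
    ENNReal.ofReal_tsum_of_nonneg (fun n => by positivity)
      ((hasSum_one_poissonMeasure r).mul_left (r : ℝ)).summable, tsum_eq_zero_add' ENNReal.summable]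
  simp only [lintegral_smul_measure, lintegral_dirac, smul_eq_mul, Nat.cast_zero, mul_zero,
    zero_add]
  refine tsum_congr fun n => ?_
  rw [← ENNReal.ofReal_natCast (n + 1), ← ENNReal.ofReal_mul (by positivity)]
  congr 1
  rw [Nat.factorial_succ]
  push_cast
  field_simp
  ring

lemma integrable_pow_poissonMeasure (r : ℝ≥0) (k : ℕ) :
    Integrable (fun n : ℕ => (n : ℝ) ^ k) (poissonMeasure r) := by
  rw [integrable_poissonMeasure_iff]
  refine Summable.of_nonneg_of_le (fun n => by positivity) (fun n => ?_)
    ((Real.summable_pow_div_factorial (r * Real.exp 1)).mul_left (Real.exp (-r) * k.factorial))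
  have h := Real.pow_div_factorial_le_exp (n : ℝ) (by positivity) k
  rw [div_le_iff₀ (by positivity)] at h
  have h2 : Real.exp n = Real.exp 1 ^ n := by rw [← Real.exp_nat_mul]; simp
  rw [Real.norm_of_nonneg (by positivity)]
  calc _ ≤ (Real.exp (-r) * r ^ n / n.factorial) * (Real.exp n * k.factorial) := by gcongr
    _ = _ := by rw [h2, mul_pow]; ring

end Moments

section Tuples
open scoped ENNReal

variable {X : Type*} [MeasurableSpace X]

open Classical in
/-- The counting measure of all `k`-tuples of elements of `V`. -/
noncomputable def tupleMeasure (k : ℕ) (V : Finset X) : Measure (Fin k → X) :=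
  ∑ x ∈ Fintype.piFinset fun _ : Fin k => V, Measure.dirac x

open Classical in
/-- The counting measure of all `k`-tuples of pairwise distinct elements of `V`. -/
noncomputable def distinctTupleMeasure (k : ℕ) (V : Finset X) : Measure (Fin k → X) :=
  ∑ x ∈ (Fintype.piFinset fun _ : Fin k => V) with Function.Injective x, Measure.dirac x

instance (k : ℕ) (V : Finset X) : IsFiniteMeasure (tupleMeasure k V) := by
  unfold tupleMeasure; infer_instance

instance (k : ℕ) (V : Finset X) : IsFiniteMeasure (distinctTupleMeasure k V) := by
  unfold distinctTupleMeasure; infer_instance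

lemma tupleMeasure_pi (k : ℕ) (V : Finset X) (A : Fin k → Set X) (hA : ∀ i, MeasurableSet (A i)) :
    tupleMeasure k V (Set.univ.pi A) = ∏ i, (((V : Set X) ∩ A i).ncard : ℝ≥0∞) := by
  classical
  have h : ∀ i, (((V : Set X) ∩ A i).ncard : ℝ≥0∞) = ∑ a ∈ V, (A i).indicator 1 a := by
    intro i
    have : (V : Set X) ∩ A i = ((V.filter (· ∈ A i) : Finset X) : Set X) := by ext; simp
    rw [this, Set.ncard_coe_finset, Finset.card_filter]
    simp [Set.indicator_apply]
  simp_rw [h]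
  rw [Finset.prod_univ_sum, tupleMeasure, Measure.finsetSum_apply]
  refine Finset.sum_congr rfl fun x _ => ?_
  rw [Measure.dirac_apply' _ (.univ_pi hA)]
  simp only [Set.indicator_apply, Set.mem_univ_pi, Pi.one_apply, Finset.prod_ite_zero,
    Finset.mem_univ, true_implies, Finset.prod_const_one]

lemma integral_distinctTupleMeasure [MeasurableSingletonClass X] (k : ℕ) (V : Finset X)
    (f : (Fin k → X) → ℝ) : ∫ x, f x ∂(distinctTupleMeasure k V) = sumDistinct k f V := by
  classical
  rw [distinctTupleMeasure, integral_finsetSum_measure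
    (fun x _ => integrable_dirac (by simp)), sumDistinct]
  simp

end Tuples

section Mecke
open scoped ENNReal

variable {X : Type*} [MeasurableSpace X] [TopologicalSpace X] [T2Space X]
  [SecondCountableTopology X] [BorelSpace X]

lemma measurableSet_injective (k : ℕ) :
    MeasurableSet {x : Fin k → X | Function.Injective x} := by
  have : {x : Fin k → X | Function.Injective x} =
      ⋂ (i : Fin k) (j : Fin k) (_ : i ≠ j), {x | x i = x j}ᶜ := by
    ext x
    simp only [Set.mem_ofPred_eq, Set.mem_iInter, Set.mem_compl_iff]
    exact ⟨fun h i j hij => h.ne hij, fun h i j hij => by_contra fun hn => h i j hn hij⟩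
  rw [this]
  exact .iInter fun i => .iInter fun j => .iInter fun _ =>
    (isClosed_eq (continuous_apply i) (continuous_apply j)).measurableSet.compl

lemma distinctTupleMeasure_eq_restrict (k : ℕ) (V : Finset X) :
    distinctTupleMeasure k V =
      (tupleMeasure k V).restrict {x | Function.Injective x} := by
  classical
  ext s hs
  rw [Measure.restrict_apply hs, tupleMeasure, distinctTupleMeasure, Measure.finsetSum_apply,
    Measure.finsetSum_apply, Finset.sum_filter]
  refine Finset.sum_congr rfl fun x _ => ?_
  rw [Measure.dirac_apply' _ hs, Measure.dirac_apply' _ (hs.inter (measurableSet_injective k))]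
  by_cases h : Function.Injective x <;> simp [Set.indicator_apply, h]

variable {Ω : Type*} [MeasurableSpace Ω] {P : Measure Ω} [IsProbabilityMeasure P]
  {Λ : Measure X} [IsFiniteMeasure Λ] {V : Ω → Finset X}

lemma IsPoissonProcess.measurable_tupleMeasure
    (hV : IsPoissonProcess P Λ V) (k : ℕ) : Measurable fun ω => tupleMeasure k (V ω) := by
  have key : ∀ A : Fin k → Set X, (∀ i, MeasurableSet (A i)) →
      Measurable fun ω => tupleMeasure k (V ω) (Set.univ.pi A) := by
    intro A hA
    simp_rw [tupleMeasure_pi k _ A hA]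
    exact Finset.measurable_prod _ fun i _ =>
      (Measurable.of_discrete (f := fun n : ℕ => (n : ℝ≥0∞))).comp (hV.measurable_count _ (hA i))
  refine Measurable.measure_of_isPiSystem generateFrom_pi.symm isPiSystem_pi ?_ ?_
  · rintro _ ⟨A, hA, rfl⟩
    exact key A fun i => hA i (Set.mem_univ i)
  · simpa using key (fun _ => Set.univ) fun _ => .univ

lemma IsPoissonProcess.measurable_distinctTupleMeasure
    (hV : IsPoissonProcess P Λ V) (k : ℕ) :
    Measurable fun ω => distinctTupleMeasure k (V ω) := by
  refine Measure.measurable_of_measurable_coe _ fun s hs => ?_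
  simp_rw [distinctTupleMeasure_eq_restrict, Measure.restrict_apply hs]
  exact (Measure.measurable_coe (hs.inter (measurableSet_injective k))).comp
    (hV.measurable_tupleMeasure k)

lemma IsPoissonProcess.lintegral_count (hV : IsPoissonProcess P Λ V) {A : Set X}
    (hA : MeasurableSet A) : ∫⁻ ω, (((V ω : Set X) ∩ A).ncard : ℝ≥0∞) ∂P = Λ A := by
  have h := lintegral_natCast_poissonMeasure (Λ A).toNNReal
  rw [← hV.law_count A hA, lintegral_map .of_discrete (hV.measurable_count A hA)] at h
  rw [h, ENNReal.coe_toNNReal (measure_ne_top _ _)]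

lemma IsPoissonProcess.bind_distinctTupleMeasure_pi (hV : IsPoissonProcess P Λ V) (k : ℕ)
    (A : Fin k → Set X) (hA : ∀ i, MeasurableSet (A i)) (hd : ∀ i j, i ≠ j → Disjoint (A i) (A j)) :
    P.bind (fun ω => distinctTupleMeasure k (V ω)) (Set.univ.pi A) = ∏ i, Λ (A i) := by
  have hinj : Set.univ.pi A ∩ {x | Function.Injective x} = Set.univ.pi A := by
    refine Set.inter_eq_left.mpr fun x hx i j hij => by_contra fun hn => ?_
    exact Set.disjoint_left.mp (hd i j hn) (hx i trivial) (hij ▸ hx j trivial)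
  rw [Measure.bind_apply (.univ_pi hA) (hV.measurable_distinctTupleMeasure k).aemeasurable]
  simp_rw [distinctTupleMeasure_eq_restrict, Measure.restrict_apply (MeasurableSet.univ_pi hA),
    hinj, tupleMeasure_pi k _ A hA]
  have hm : ∀ i, Measurable fun ω => (((V ω : Set X) ∩ A i).ncard : ℝ≥0∞) := fun i =>
    (Measurable.of_discrete (f := fun n : ℕ => (n : ℝ≥0∞))).comp (hV.measurable_count _ (hA i))
  rw [lintegral_prod_eq_prod_lintegral_of_indepFun Finset.univ
    (fun i ω => (((V ω : Set X) ∩ A i).ncard : ℝ≥0∞)) ?_ hm]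
  · exact Finset.prod_congr rfl fun i _ => hV.lintegral_count (hA i)
  · exact (hV.indep_count k A hA hd).comp (fun _ n => (n : ℝ≥0∞)) fun _ => .of_discrete

/-- Injective tuples in a second countable Hausdorff space are covered by countably many products
of pairwise disjoint open sets. -/
lemma exists_countable_disjoint_open_cover (k : ℕ) :
    ∃ S : Set (Fin k → Set X), S.Countable ∧
      (∀ A ∈ S, (∀ i, IsOpen (A i)) ∧ ∀ i j, i ≠ j → Disjoint (A i) (A j)) ∧
      {x : Fin k → X | Function.Injective x} ⊆ ⋃ A ∈ S, Set.univ.pi A := by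
  have hb := TopologicalSpace.isBasis_countableBasis X
  refine ⟨{A | (∀ i, A i ∈ TopologicalSpace.countableBasis X) ∧
    ∀ i j, i ≠ j → Disjoint (A i) (A j)}, ?_, ?_, ?_⟩
  · refine (Set.countable_univ_pi fun _ : Fin k =>
      TopologicalSpace.countable_countableBasis X).mono ?_
    rintro A ⟨h, -⟩ i _
    exact h i
  · exact fun A hA => ⟨fun i => hb.isOpen (hA.1 i), hA.2⟩
  · intro x hx
    obtain ⟨U, hU, hd⟩ := (Set.finite_range x).t2_separation
    choose A hA using fun i => hb.exists_subset_of_mem_open (hU (x i)).1 (hU (x i)).2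
    refine Set.mem_iUnion₂.mpr ⟨A, ⟨fun i => (hA i).1, fun i j hij => ?_⟩, fun i _ => (hA i).2.1⟩
    exact (hd (Set.mem_range_self i) (Set.mem_range_self j) (hx.ne hij)).mono (hA i).2.2 (hA j).2.2

lemma pi_injective_compl [NullSingletonClass Λ] (k : ℕ) :
    Measure.pi (fun _ : Fin k => Λ) {x | Function.Injective x}ᶜ = 0 := by
  have : {x : Fin k → X | Function.Injective x}ᶜ =
      ⋃ (i : Fin k) (j : Fin k) (_ : i ≠ j), {x | x i = x j} := by
    ext x
    simp only [Set.mem_compl_iff, Set.mem_ofPred_eq, Function.Injective, Set.mem_iUnion]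
    push Not
    exact exists_congr fun i => exists_congr fun j => and_comm.trans (by simp)
  rw [this, measure_iUnion_null_iff]
  intro i
  rw [measure_iUnion_null_iff]
  intro j
  rw [measure_iUnion_null_iff]
  intro hij
  cases k with
  | zero => exact i.elim0
  | succ n =>
    obtain ⟨j, rfl⟩ := Fin.exists_succAbove_eq (Ne.symm hij)
    have hcl : MeasurableSet {p : X × (Fin n → X) | p.1 = p.2 j} :=
      (isClosed_eq (f := fun p : X × (Fin n → X) => p.1) (g := fun p => p.2 j)
        (by fun_prop) (by fun_prop)).measurableSet
    have h := (measurePreserving_piFinSuccAbove (fun _ : Fin (n + 1) => Λ) i).measure_preimage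
      hcl.nullMeasurableSet
    rw [Measure.prod_apply_symm hcl] at h
    refine Eq.trans ?_ (h.trans ?_)
    · rfl
    · have : ∀ y : Fin n → X, (fun a => (a, y)) ⁻¹' {p : X × (Fin n → X) | p.1 = p.2 j} = {y j} :=
        fun y => rfl
      simp [this]

/-- The multivariate Mecke formula. -/
theorem IsPoissonProcess.bind_distinctTupleMeasure [NullSingletonClass Λ] (hV : IsPoissonProcess P Λ V)
    (k : ℕ) :
    P.bind (fun ω => distinctTupleMeasure k (V ω)) = Measure.pi fun _ => Λ := by
  set M := P.bind (fun ω => distinctTupleMeasure k (V ω)) with hM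
  obtain ⟨S, hSc, hS, hcover⟩ := exists_countable_disjoint_open_cover (X := X) k
  have hM0 : M {x | Function.Injective x}ᶜ = 0 := by
    rw [hM, Measure.bind_apply (measurableSet_injective k).compl
      (hV.measurable_distinctTupleMeasure k).aemeasurable]
    simp [distinctTupleMeasure_eq_restrict, Measure.restrict_apply
      (measurableSet_injective (X := X) k).compl]
  have hU : MeasurableSet (⋃ A ∈ S, Set.univ.pi A) := .biUnion hSc fun A hA =>
    .univ_pi fun i => ((hS A hA).1 i).measurableSet
  have key : M.restrict (⋃ A ∈ S, Set.univ.pi A) =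
      (Measure.pi fun _ => Λ).restrict (⋃ A ∈ S, Set.univ.pi A) := by
    rw [Measure.restrict_biUnion_congr hSc]
    intro A hA
    obtain ⟨hAo, hAd⟩ := hS A hA
    have hAm : MeasurableSet (Set.univ.pi A) := .univ_pi fun i => (hAo i).measurableSet
    have hfin : IsFiniteMeasure (M.restrict (Set.univ.pi A)) := ⟨by
      rw [Measure.restrict_apply_univ, hM, hV.bind_distinctTupleMeasure_pi k A
        (fun i => (hAo i).measurableSet) hAd]
      exact ENNReal.prod_lt_top fun i _ => measure_lt_top _ _⟩
    have heq : ∀ B : Fin k → Set X, (∀ i, MeasurableSet (B i)) →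
        M.restrict (Set.univ.pi A) (Set.univ.pi B) =
          (Measure.pi fun _ => Λ).restrict (Set.univ.pi A) (Set.univ.pi B) := by
      intro B hB
      rw [Measure.restrict_apply (.univ_pi hB), Measure.restrict_apply (.univ_pi hB),
        ← Set.pi_inter_distrib, Measure.pi_pi, hM, hV.bind_distinctTupleMeasure_pi k
          (fun i => B i ∩ A i) (fun i => (hB i).inter (hAo i).measurableSet)
          fun i j hij => (hAd i j hij).mono Set.inter_subset_right Set.inter_subset_right]
    refine ext_of_generate_finite _ generateFrom_pi.symm isPiSystem_pi ?_ ?_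
    · rintro _ ⟨B, hB, rfl⟩
      exact heq B fun i => hB i (Set.mem_univ i)
    · simpa using heq (fun _ => Set.univ) fun _ => .univ
  rw [← Measure.restrict_eq_self_of_ae_mem (μ := M) (s := ⋃ A ∈ S, Set.univ.pi A), key,
    Measure.restrict_eq_self_of_ae_mem]
  · exact measure_mono_null (Set.compl_subset_compl.mpr hcover) (pi_injective_compl k)
  · exact measure_mono_null (Set.compl_subset_compl.mpr hcover) hM0

lemma IsPoissonProcess.integrable_integral_distinctTupleMeasure [NullSingletonClass Λ]
    (hV : IsPoissonProcess P Λ V) {k : ℕ} {f : (Fin k → X) → ℝ}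
    (hf : Integrable f (Measure.pi fun _ => Λ)) :
    Integrable (fun ω => sumDistinct k f (V ω)) P ∧
      ∫ ω, sumDistinct k f (V ω) ∂P = ∫ x, f x ∂(Measure.pi fun _ => Λ) := by
  let κ : Kernel Ω (Fin k → X) :=
    ⟨fun ω => distinctTupleMeasure k (V ω), hV.measurable_distinctTupleMeasure k⟩
  have hκ : P.bind κ = Measure.pi fun _ => Λ := hV.bind_distinctTupleMeasure k
  have hs : ∀ ω, sumDistinct k f (V ω) = ∫ x, f x ∂(κ ω) := fun ω =>
    (integral_distinctTupleMeasure k (V ω) f).symm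
  simp_rw [hs, ← hκ]
  rw [← hκ] at hf
  rw [Measure.comp_eq_comp_const_apply] at hf ⊢
  rw [Kernel.integral_comp hf]
  simpa using hf.integral_comp

theorem IsPoissonProcess.integrable_sumDistinct [NullSingletonClass Λ]
    (hV : IsPoissonProcess P Λ V) {k : ℕ} {f : (Fin k → X) → ℝ}
    (hf : Integrable f (Measure.pi fun _ => Λ)) :
    Integrable (fun ω => sumDistinct k f (V ω)) P :=
  (hV.integrable_integral_distinctTupleMeasure hf).1

theorem IsPoissonProcess.integral_sumDistinct [NullSingletonClass Λ]
    (hV : IsPoissonProcess P Λ V) {k : ℕ} {f : (Fin k → X) → ℝ}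
    (hf : Integrable f (Measure.pi fun _ => Λ)) :
    ∫ ω, sumDistinct k f (V ω) ∂P = ∫ x, f x ∂(Measure.pi fun _ => Λ) :=
  (hV.integrable_integral_distinctTupleMeasure hf).2

lemma IsPoissonProcess.integrable_card_pow (hV : IsPoissonProcess P Λ V) (k : ℕ) :
    Integrable (fun ω => ((V ω).card : ℝ) ^ k) P := by
  have h := integrable_pow_poissonMeasure (Λ Set.univ).toNNReal k
  rw [← hV.law_count _ .univ] at h
  have h2 := h.comp_measurable (hV.measurable_count _ .univ)
  simpa [Function.comp_def] using h2

lemma IsPoissonProcess.ae_subset (hV : IsPoissonProcess P Λ V) {A : Set X}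
    (hA : MeasurableSet A) (h0 : Λ Aᶜ = 0) : ∀ᵐ ω ∂P, (V ω : Set X) ⊆ A := by
  have h := hV.lintegral_count hA.compl
  rw [h0, lintegral_eq_zero_iff] at h
  · filter_upwards [h] with ω hω x hx
    by_contra hxA
    have h1 : ((V ω : Set X) ∩ Aᶜ).ncard = 0 := by simpa using hω
    rw [Set.ncard_eq_zero ((V ω).finite_toSet.inter_of_left _)] at h1
    exact Set.eq_empty_iff_forall_notMem.mp h1 x ⟨hx, hxA⟩
  · exact (Measurable.of_discrete (f := fun n : ℕ => (n : ℝ≥0∞))).comp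
      (hV.measurable_count _ hA.compl)

lemma abs_sumDistinct_le {k : ℕ} {f : (Fin k → X) → ℝ} {V : Finset X} {C : ℝ} (hC : 0 ≤ C)
    (hf : ∀ x, (∀ i, x i ∈ V) → |f x| ≤ C) : |sumDistinct k f V| ≤ C * (V.card : ℝ) ^ k := by
  classical
  refine (Finset.abs_sum_le_sum_abs _ _).trans ?_
  refine (Finset.sum_le_card_nsmul _ _ C fun x hx => hf x fun i => ?_).trans ?_
  · exact Fintype.mem_piFinset.mp (Finset.mem_filter.mp hx).1 i
  · rw [nsmul_eq_mul, mul_comm]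
    gcongr
    refine (Nat.cast_le.mpr (Finset.card_filter_le _ _)).trans ?_
    simp

/-- Factorial sums of functions that are bounded on the support of the intensity measure are
square integrable. -/
lemma IsPoissonProcess.memLp_sumDistinct [NullSingletonClass Λ] (hV : IsPoissonProcess P Λ V)
    {A : Set X} (hA : MeasurableSet A) (h0 : Λ Aᶜ = 0) {k : ℕ} {f : (Fin k → X) → ℝ}
    (hf : Integrable f (Measure.pi fun _ => Λ)) {C : ℝ} (hC : 0 ≤ C)
    (hfC : ∀ x, (∀ i, x i ∈ A) → |f x| ≤ C) :
    MemLp (fun ω => sumDistinct k f (V ω)) 2 P := by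
  have hm := (hV.integrable_sumDistinct hf).aestronglyMeasurable
  rw [memLp_two_iff_integrable_sq hm]
  refine ((hV.integrable_card_pow (2 * k)).const_mul (C ^ 2)).mono' (hm.pow 2) ?_
  filter_upwards [hV.ae_subset hA h0] with ω hω
  have := abs_sumDistinct_le hC (V := V ω) fun x hx => hfC x fun i => hω (hx i)
  rw [Real.norm_eq_abs, abs_pow]
  calc _ ≤ (C * ((V ω).card : ℝ) ^ k) ^ 2 := by gcongr
    _ = _ := by ring

end Mecke

section Combinatorics

variable {X : Type*}

open Classical in
lemma sumDistinct_succ (k : ℕ) (h : (Fin (k + 1) → X) → ℝ) (V : Finset X) :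
    sumDistinct (k + 1) h V = sumDistinct k
      (fun x => ∑ a ∈ V \ Finset.univ.image x, h (Fin.cons a x)) V := by
  unfold sumDistinct
  rw [Finset.sum_sigma']
  refine Finset.sum_bij' (fun z _ => ⟨Fin.tail z, z 0⟩) (fun p _ => Fin.cons p.2 p.1)
    ?_ ?_ ?_ ?_ ?_
  · intro z hz
    simp only [Finset.mem_filter, Fintype.mem_piFinset] at hz
    simp only [Finset.mem_sigma, Finset.mem_filter, Fintype.mem_piFinset, Finset.mem_sdiff,
      Finset.mem_image, Finset.mem_univ, true_and]
    refine ⟨⟨fun i => hz.1 _, fun i j hij => Fin.succ_injective _ (hz.2 hij)⟩, hz.1 0, ?_⟩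
    rintro ⟨i, hi⟩
    exact Fin.succ_ne_zero i (hz.2 hi)
  · rintro ⟨x, a⟩ hp
    simp only [Finset.mem_sigma, Finset.mem_filter, Fintype.mem_piFinset, Finset.mem_sdiff,
      Finset.mem_image, Finset.mem_univ, true_and, not_exists] at hp
    simp only [Finset.mem_filter, Fintype.mem_piFinset]
    refine ⟨fun i => ?_, Fin.cons_injective_iff.mpr ⟨fun ⟨i, hi⟩ => hp.2.2 i hi, hp.1.2⟩⟩
    refine Fin.cases ?_ (fun j => ?_) i
    · simpa using hp.2.1
    · simpa using hp.1.1 j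
  · intro z _
    simp
  · rintro ⟨x, a⟩ _
    simp
  · intro z _
    simp

lemma sumDistinct_zero (h : (Fin 0 → X) → ℝ) (V : Finset X) :
    sumDistinct 0 h V = h Fin.elim0 := by
  classical
  have : ((Fintype.piFinset fun _ : Fin 0 => V).filter Function.Injective) = {Fin.elim0} := by
    ext x
    simp only [Finset.mem_filter, Fintype.mem_piFinset, Finset.mem_singleton,
      Function.injective_of_subsingleton, and_true, IsEmpty.forall_iff, true_iff]
    exact Subsingleton.elim _ _
  unfold sumDistinct
  rw [Finset.sum_congr (by convert this) fun _ _ => rfl]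
  simp

open Classical in
lemma sumDistinct_two (g : X → X → ℝ) (V : Finset X) :
    sumDistinct 2 (fun y => g (y 0) (y 1)) V = ∑ b ∈ V, ∑ a ∈ V, if a = b then 0 else g a b := by
  have h1 : Finset.univ.image (Fin.elim0 : Fin 0 → X) = ∅ := by ext; simp
  rw [sumDistinct_succ, sumDistinct_succ, sumDistinct_zero, h1, Finset.sdiff_empty]
  refine Finset.sum_congr rfl fun b _ => ?_
  have h2 : Finset.univ.image (Fin.cons b Fin.elim0 : Fin 1 → X) = {b} := by
    ext; simp [eq_comm]
  rw [h2, Finset.sdiff_singleton_eq_erase, ← Finset.filter_ne', Finset.sum_filter]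
  refine Finset.sum_congr rfl fun a _ => ?_
  by_cases h : a = b <;> simp [h]

lemma sumDistinct_add (k : ℕ) (f g : (Fin k → X) → ℝ) (V : Finset X) :
    sumDistinct k (fun x => f x + g x) V = sumDistinct k f V + sumDistinct k g V := by
  simp [sumDistinct, Finset.sum_add_distrib]

lemma sumDistinct_mul_const (k : ℕ) (f : (Fin k → X) → ℝ) (c : ℝ) (V : Finset X) :
    sumDistinct k f V * c = sumDistinct k (fun x => f x * c) V := by
  simp [sumDistinct, Finset.sum_mul]

lemma sumDistinct_congr {k : ℕ} {f g : (Fin k → X) → ℝ} {V : Finset X}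
    (h : ∀ x, (∀ i, x i ∈ V) → Function.Injective x → f x = g x) :
    sumDistinct k f V = sumDistinct k g V := by
  classical
  refine Finset.sum_congr rfl fun x hx => h x (fun i => ?_) (Finset.mem_filter.mp hx).2
  exact Fintype.mem_piFinset.mp (Finset.mem_filter.mp hx).1 i

/-- A product of factorial sums is a sum of factorial sums, according to the number of common
points. -/
lemma sumDistinct_mul_sumDistinct_two (k : ℕ) (f : (Fin k → X) → ℝ) (g : X → X → ℝ)
    (V : Finset X) :
    sumDistinct k f V * sumDistinct 2 (fun y => g (y 0) (y 1)) V =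
      sumDistinct (k + 2) (fun z => f (Fin.tail (Fin.tail z)) * g (z 0) (z 1)) V +
      sumDistinct (k + 1) (fun z => f (Fin.tail z) *
        ∑ i, (g (z 0) (Fin.tail z i) + g (Fin.tail z i) (z 0))) V +
      sumDistinct k (fun x => f x * ∑ i, ∑ j, if i = j then 0 else g (x i) (x j)) V := by
  classical
  rw [sumDistinct_mul_const, sumDistinct_succ (k + 1), sumDistinct_succ k, sumDistinct_succ k,
    ← sumDistinct_add, ← sumDistinct_add]
  refine sumDistinct_congr fun x hxV hx => ?_
  rw [sumDistinct_two]
  have hsplit : ∀ F : X → ℝ, ∑ a ∈ V, F a = (∑ i, F (x i)) +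
      ∑ a ∈ V \ Finset.univ.image x, F a := by
    intro F
    have hsub : Finset.univ.image x ⊆ V := by
      intro a ha
      obtain ⟨i, -, rfl⟩ := Finset.mem_image.mp ha
      exact hxV i
    rw [← Finset.sum_sdiff hsub, add_comm, Finset.sum_image fun i _ j _ h => hx h]
  have hne : ∀ b ∈ V \ Finset.univ.image x, ∀ i, x i ≠ b := by
    intro b hb i hi
    exact (Finset.mem_sdiff.mp hb).2 (Finset.mem_image.mpr ⟨i, Finset.mem_univ _, hi⟩)
  have hcons : ∀ b, V \ Finset.univ.image (Fin.cons b x : Fin (k + 1) → X) =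
      (V \ Finset.univ.image x).filter (· ≠ b) := by
    intro b
    ext a
    simp only [Finset.mem_sdiff, Finset.mem_image, Finset.mem_univ, true_and, Fin.exists_fin_succ,
      Fin.cons_zero, Fin.cons_succ, Finset.mem_filter, not_or, ne_eq, eq_comm (a := b)]
    tauto
  have e1 : ∑ b ∈ V, ∑ a ∈ V, (if a = b then 0 else g a b) =
      (∑ i, ∑ j, if i = j then 0 else g (x i) (x j)) +
      (∑ a ∈ V \ Finset.univ.image x, ∑ i, (g a (x i) + g (x i) a)) +
      ∑ b ∈ V \ Finset.univ.image x, ∑ a ∈ V \ Finset.univ.image x,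
        (if a = b then 0 else g a b) := by
    rw [hsplit]
    simp_rw [hsplit (fun a => if a = _ then 0 else g a _)]
    rw [Finset.sum_add_distrib, Finset.sum_add_distrib]
    have t1 : ∑ i, ∑ j, (if x j = x i then 0 else g (x j) (x i)) =
        ∑ i, ∑ j, if i = j then 0 else g (x i) (x j) := by
      rw [Finset.sum_comm]
      simp [hx.eq_iff]
    have t2 : ∑ i, ∑ a ∈ V \ Finset.univ.image x, (if a = x i then 0 else g a (x i)) =
        ∑ a ∈ V \ Finset.univ.image x, ∑ i, g a (x i) := by
      rw [Finset.sum_comm]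
      refine Finset.sum_congr rfl fun a ha => Finset.sum_congr rfl fun i _ => ?_
      rw [if_neg (hne a ha i).symm]
    have t3 : ∑ b ∈ V \ Finset.univ.image x, ∑ i, (if x i = b then 0 else g (x i) b) =
        ∑ a ∈ V \ Finset.univ.image x, ∑ i, g (x i) a :=
      Finset.sum_congr rfl fun a ha => Finset.sum_congr rfl fun i _ => by rw [if_neg (hne a ha i)]
    simp_rw [Finset.sum_add_distrib]
    rw [t1, t2, t3]
    ring
  rw [e1]
  simp_rw [hcons, Finset.sum_filter, Fin.tail_cons, Fin.cons_zero, Fin.cons_one]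
  rw [mul_add, mul_add, Finset.mul_sum (V \ Finset.univ.image x),
    Finset.mul_sum (V \ Finset.univ.image x)]
  simp_rw [Finset.mul_sum (V \ Finset.univ.image x)]
  have : ∀ a b, f x * (if a = b then 0 else g a b) = if a ≠ b then f x * g a b else 0 := by
    intro a b
    by_cases h : a = b <;> simp [h]
  simp_rw [this]
  simp only [Fin.cons_zero]
  ring

end Combinatorics

section Covariance
open scoped ENNReal

variable {X : Type*} [MeasurableSpace X] {Λ : Measure X} [IsFiniteMeasure Λ]

lemma measurePreserving_cons (k : ℕ) :
    MeasurePreserving (fun p : X × (Fin k → X) => (Fin.cons p.1 p.2 : Fin (k + 1) → X))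
      (Λ.prod (Measure.pi fun _ => Λ)) (Measure.pi fun _ => Λ) := by
  have h := (measurePreserving_piFinSuccAbove (fun _ : Fin (k + 1) => Λ) 0).symm
  convert h using 1
  ext p : 1
  simp [MeasurableEquiv.piFinSuccAbove, Fin.insertNthEquiv]

lemma measurableEmbedding_cons (k : ℕ) :
    MeasurableEmbedding (fun p : X × (Fin k → X) => (Fin.cons p.1 p.2 : Fin (k + 1) → X)) := by
  convert (MeasurableEquiv.piFinSuccAbove (fun _ : Fin (k + 1) => X) 0).symm.measurableEmbedding
    using 1
  ext p : 1
  simp [MeasurableEquiv.piFinSuccAbove, Fin.insertNthEquiv]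

lemma integral_pi_succ (k : ℕ) (h : (Fin (k + 1) → X) → ℝ) :
    ∫ z, h z ∂(Measure.pi fun _ => Λ) =
      ∫ p, h (Fin.cons p.1 p.2) ∂(Λ.prod (Measure.pi fun _ : Fin k => Λ)) :=
  ((measurePreserving_cons k).integral_comp (measurableEmbedding_cons k) h).symm

lemma lintegral_pi_succ (k : ℕ) (h : (Fin (k + 1) → X) → ℝ≥0∞) (hh : Measurable h) :
    ∫⁻ z, h z ∂(Measure.pi fun _ => Λ) =
      ∫⁻ a, ∫⁻ x, h (Fin.cons a x) ∂(Measure.pi fun _ : Fin k => Λ) ∂Λ := by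
  rw [← (measurePreserving_cons k).lintegral_comp hh, lintegral_prod]
  exact (hh.comp (measurePreserving_cons (Λ := Λ) k).measurable).aemeasurable

lemma integrable_of_bounded {Y : Type*} [MeasurableSpace Y] {μ : Measure Y} [IsFiniteMeasure μ]
    {f : Y → ℝ} (hf : Measurable f) {C : ℝ} (hC : ∀ x, |f x| ≤ C) : Integrable f μ :=
  Integrable.of_bound hf.aestronglyMeasurable C (ae_of_all _ hC)

lemma integral_pi_two (g : X → X → ℝ) :
    ∫ y, g (y 0) (y 1) ∂(Measure.pi fun _ : Fin 2 => Λ) =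
      ∫ p, g p.1 p.2 ∂(Λ.prod Λ) := by
  rw [← (measurePreserving_finTwoArrow Λ).integral_comp
    MeasurableEquiv.finTwoArrow.measurableEmbedding]
  rfl

lemma integral_pi_add_two (k : ℕ) (f : (Fin k → X) → ℝ) (g : X → X → ℝ) :
    ∫ z, f (Fin.tail (Fin.tail z)) * g (z 0) (z 1) ∂(Measure.pi fun _ : Fin (k + 2) => Λ) =
      (∫ x, f x ∂(Measure.pi fun _ => Λ)) * ∫ y, g (y 0) (y 1) ∂(Measure.pi fun _ : Fin 2 => Λ) := by
  rw [integral_pi_two, mul_comm, ← integral_prod_mul (fun p : X × X => g p.1 p.2) f,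
    integral_pi_succ]
  have h1 := ((MeasurePreserving.id Λ).prod (measurePreserving_cons (Λ := Λ) k)).integral_comp
    (MeasurableEmbedding.id.prodMap (measurableEmbedding_cons k))
    (fun p : X × (Fin (k + 1) → X) =>
      f (Fin.tail (Fin.tail (Fin.cons p.1 p.2 : Fin (k + 2) → X))) *
        g ((Fin.cons p.1 p.2 : Fin (k + 2) → X) 0) ((Fin.cons p.1 p.2 : Fin (k + 2) → X) 1))
  have h2 := (measurePreserving_prodAssoc Λ Λ (Measure.pi fun _ : Fin k => Λ)).integral_comp
    MeasurableEquiv.prodAssoc.measurableEmbedding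
    (fun p : X × (X × (Fin k → X)) => f p.2.2 * g p.1 p.2.1)
  rw [← h1]
  refine Eq.trans ?_ (h2.symm.trans ?_)
  · rfl
  · refine integral_congr_ae (ae_of_all _ fun p => ?_)
    simp [MeasurableEquiv.prodAssoc, mul_comm]

variable [TopologicalSpace X] [T2Space X] [SecondCountableTopology X] [BorelSpace X]
  {Ω : Type*} [MeasurableSpace Ω] {P : Measure Ω} [IsProbabilityMeasure P] {V : Ω → Finset X}

/-- The covariance of two Poisson factorial sums, the second of order two. -/
theorem IsPoissonProcess.covariance_sumDistinct [NullSingletonClass Λ]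
    (hV : IsPoissonProcess P Λ V) (k : ℕ) {f : (Fin k → X) → ℝ} (hf : Measurable f) {C : ℝ}
    (hfC : ∀ x, |f x| ≤ C) {g : X → X → ℝ} (hg : Measurable (Function.uncurry g)) {D : ℝ}
    (hgD : ∀ a b, |g a b| ≤ D) (hC : 0 ≤ C) (hD : 0 ≤ D) :
    covariance (fun ω => sumDistinct k f (V ω))
        (fun ω => sumDistinct 2 (fun y => g (y 0) (y 1)) (V ω)) P =
      ∫ x, f x * ∑ i, ∫ a, (g a (x i) + g (x i) a) ∂Λ ∂(Measure.pi fun _ => Λ) +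
      ∫ x, f x * ∑ i, ∑ j, (if i = j then 0 else g (x i) (x j)) ∂(Measure.pi fun _ => Λ) := by
  have hgm : ∀ {Y : Type _} [MeasurableSpace Y] {u v : Y → X}, Measurable u → Measurable v →
      Measurable fun y => g (u y) (v y) := fun hu hv => hg.comp (hu.prodMk hv)
  have htail : ∀ n : ℕ, Measurable (Fin.tail : (Fin (n + 1) → X) → Fin n → X) := fun n =>
    measurable_pi_lambda _ fun i => measurable_pi_apply _
  have hfi : Integrable f (Measure.pi fun _ => Λ) := integrable_of_bounded hf hfC
  have hg2 : Measurable fun y : Fin 2 → X => g (y 0) (y 1) :=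
    hgm (measurable_pi_apply 0) (measurable_pi_apply 1)
  have hgi : Integrable (fun y : Fin 2 → X => g (y 0) (y 1)) (Measure.pi fun _ => Λ) :=
    integrable_of_bounded hg2 fun y => hgD _ _
  have hF := hV.memLp_sumDistinct .univ (by simp) hfi hC fun x _ => hfC x
  have hG := hV.memLp_sumDistinct .univ (by simp) hgi hD fun x _ => hgD _ _
  have i6 : Integrable (fun z : Fin (k + 2) → X => f (Fin.tail (Fin.tail z)) * g (z 0) (z 1))
      (Measure.pi fun _ => Λ) := by
    refine integrable_of_bounded (C := C * D) ?_ fun z => ?_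
    · exact (hf.comp ((htail _).comp (htail _))).mul
        (hgm (measurable_pi_apply 0) (measurable_pi_apply 1))
    · rw [abs_mul]
      exact mul_le_mul (hfC _) (hgD _ _) (abs_nonneg _) hC
  have hm5 : Measurable fun p : X × (Fin k → X) =>
      f p.2 * ∑ i, (g p.1 (p.2 i) + g (p.2 i) p.1) := by
    refine (hf.comp measurable_snd).mul (Finset.measurable_sum _ fun i _ => ?_)
    have : Measurable fun p : X × (Fin k → X) => p.2 i := by fun_prop
    exact (hgm measurable_fst this).add (hgm this measurable_fst)
  have hb5 : ∀ (a : X) (x : Fin k → X),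
      |f x * ∑ i, (g a (x i) + g (x i) a)| ≤ C * (k * (D + D)) := by
    intro a x
    rw [abs_mul]
    refine mul_le_mul (hfC _) ?_ (abs_nonneg _) hC
    refine (Finset.abs_sum_le_sum_abs _ _).trans ((Finset.sum_le_card_nsmul _ _ (D + D)
      fun i _ => (abs_add_le _ _).trans (add_le_add (hgD _ _) (hgD _ _))).trans ?_)
    simp [mul_add]
  have i5 : Integrable (fun z : Fin (k + 1) → X => f (Fin.tail z) *
      ∑ i, (g (z 0) (Fin.tail z i) + g (Fin.tail z i) (z 0))) (Measure.pi fun _ => Λ) := by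
    refine integrable_of_bounded (C := C * (k * (D + D))) ?_ fun z => hb5 _ _
    exact hm5.comp ((measurable_pi_apply 0).prodMk (htail k))
  have i4 : Integrable (fun x : Fin k → X => f x *
      ∑ i, ∑ j, if i = j then 0 else g (x i) (x j)) (Measure.pi fun _ => Λ) := by
    refine integrable_of_bounded (C := C * (k * (k * D))) ?_ fun x => ?_
    · refine hf.mul (Finset.measurable_sum _ fun i _ => Finset.measurable_sum _ fun j _ => ?_)
      by_cases h : i = j
      · simp [h]
      · simpa [h] using hgm (measurable_pi_apply i) (measurable_pi_apply j)
    · rw [abs_mul]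
      refine mul_le_mul (hfC _) ?_ (abs_nonneg _) hC
      refine (Finset.abs_sum_le_sum_abs _ _).trans ((Finset.sum_le_card_nsmul _ _ (k * D)
        fun i _ => ?_).trans (by simp))
      refine (Finset.abs_sum_le_sum_abs _ _).trans ((Finset.sum_le_card_nsmul _ _ D
        fun j _ => ?_).trans (by simp))
      by_cases h : i = j
      · simpa [h] using hD
      · simpa [h] using hgD _ _
  rw [covariance_eq_sub hF hG]
  simp only [Pi.mul_apply, sumDistinct_mul_sumDistinct_two]
  have i65 : Integrable (fun ω =>
      sumDistinct (k + 2) (fun z => f (Fin.tail (Fin.tail z)) * g (z 0) (z 1)) (V ω) +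
      sumDistinct (k + 1) (fun z => f (Fin.tail z) *
        ∑ i, (g (z 0) (Fin.tail z i) + g (Fin.tail z i) (z 0))) (V ω)) P :=
    (hV.integrable_sumDistinct i6).add (hV.integrable_sumDistinct i5)
  rw [integral_add i65 (hV.integrable_sumDistinct i4), integral_add (hV.integrable_sumDistinct i6)
    (hV.integrable_sumDistinct i5), hV.integral_sumDistinct i6, hV.integral_sumDistinct i5,
    hV.integral_sumDistinct i4, hV.integral_sumDistinct hfi, hV.integral_sumDistinct hgi,
    integral_pi_add_two, integral_pi_succ k]
  simp only [Fin.tail_cons, Fin.cons_zero]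
  rw [integral_prod_symm _ (integrable_of_bounded hm5 fun p => hb5 p.1 p.2)]
  simp_rw [integral_const_mul]
  have : ∀ x : Fin k → X, ∫ a, ∑ i, (g a (x i) + g (x i) a) ∂Λ =
      ∑ i, ∫ a, (g a (x i) + g (x i) a) ∂Λ := fun x =>
    integral_finsetSum _ fun i _ => (integrable_of_bounded (hgm measurable_id measurable_const)
      fun a => hgD _ _).add (integrable_of_bounded (hgm measurable_const measurable_id)
        fun a => hgD _ _)
  simp_rw [this]
  ring

end Covariance

section PlaneCoordinates
open scoped ENNReal

/-- The first two coordinates. -/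
noncomputable def planeCoord (m : ℕ) : EuclideanSpace ℝ (Fin (m + 2)) →L[ℝ] ℝ × ℝ :=
  (EuclideanSpace.proj 0).prod (EuclideanSpace.proj 1)

/-- The coordinates from the third on. -/
noncomputable def restCoord (m : ℕ) (x : EuclideanSpace ℝ (Fin (m + 2))) :
    EuclideanSpace ℝ (Fin m) :=
  WithLp.toLp 2 fun i => x i.succ.succ

@[simp] lemma planeCoord_fst {m : ℕ} (x : EuclideanSpace ℝ (Fin (m + 2))) :
    (planeCoord m x).1 = x 0 := rfl

@[simp] lemma planeCoord_snd {m : ℕ} (x : EuclideanSpace ℝ (Fin (m + 2))) :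
    (planeCoord m x).2 = x 1 := rfl

@[simp] lemma restCoord_apply {m : ℕ} (x : EuclideanSpace ℝ (Fin (m + 2))) (i : Fin m) :
    restCoord m x i = x i.succ.succ := rfl

lemma measurePreserving_planeCoord_restCoord (m : ℕ) :
    MeasurePreserving (fun x => (planeCoord m x, restCoord m x)) volume volume := by
  have h1 := PiLp.volume_preserving_ofLp (Fin (m + 2))
  have h2 := volume_preserving_piFinSuccAbove (fun _ : Fin (m + 2) => ℝ) 0
  have h3 := (MeasurePreserving.id (volume : Measure ℝ)).prod
    (volume_preserving_piFinSuccAbove (fun _ : Fin (m + 1) => ℝ) 0)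
  have h4 := (measurePreserving_prodAssoc (volume : Measure ℝ) (volume : Measure ℝ)
    (volume : Measure (Fin m → ℝ))).symm
  have h5 := (MeasurePreserving.id (volume : Measure (ℝ × ℝ))).prod
    (PiLp.volume_preserving_toLp (Fin m))
  exact h5.comp (h4.comp (h3.comp (h2.comp h1)))

lemma norm_sq_eq_planeCoord_add_restCoord {m : ℕ} (x : EuclideanSpace ℝ (Fin (m + 2))) :
    ‖x‖ ^ 2 = (planeCoord m x).1 ^ 2 + (planeCoord m x).2 ^ 2 + ‖restCoord m x‖ ^ 2 := by
  simp [EuclideanSpace.norm_sq_eq, Fin.sum_univ_succ, add_assoc]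

/-- The linear map `(s, t) ↦ s a - t b`. -/
noncomputable def segDiffMap (a b : ℝ × ℝ) : ℝ × ℝ →ₗ[ℝ] ℝ × ℝ :=
  (LinearMap.fst ℝ ℝ ℝ).smulRight a - (LinearMap.snd ℝ ℝ ℝ).smulRight b

/-- The difference set of the segments `[0, a]` and `[0, b]`. -/
def segDiff (a b : ℝ × ℝ) : Set (ℝ × ℝ) :=
  segDiffMap a b '' (Set.Icc (0 : ℝ) 1 ×ˢ Set.Icc (0 : ℝ) 1)

lemma mem_segDiff {a b p : ℝ × ℝ} :
    p ∈ segDiff a b ↔ ∃ s ∈ Set.Icc (0 : ℝ) 1, ∃ t ∈ Set.Icc (0 : ℝ) 1, s • a - t • b = p := by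
  simp only [segDiff, segDiffMap, Set.mem_image, Prod.exists, Set.mem_prod]
  constructor
  · rintro ⟨s, t, ⟨hs, ht⟩, h⟩
    exact ⟨s, hs, t, ht, h⟩
  · rintro ⟨s, hs, t, ht, h⟩
    exact ⟨s, t, ⟨hs, ht⟩, h⟩

/-- The area of the parallelogram spanned by two vectors of the plane. -/
def planeArea (a b : ℝ × ℝ) : ℝ := |a.1 * b.2 - a.2 * b.1|

lemma volume_segDiff (a b : ℝ × ℝ) : volume (segDiff a b) = ENNReal.ofReal (planeArea a b) := by
  have hdet : LinearMap.det (segDiffMap a b) = a.2 * b.1 - a.1 * b.2 := by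
    rw [← LinearMap.det_toMatrix (Module.Basis.finTwoProd ℝ), Matrix.det_fin_two]
    simp [LinearMap.toMatrix_apply, segDiffMap]
    ring
  rw [segDiff, Measure.addHaar_image_linearMap, hdet, Measure.volume_eq_prod, Measure.prod_prod,
    planeArea, abs_sub_comm]
  simp

lemma isClosed_segDiff :
    IsClosed {p : (ℝ × ℝ) × (ℝ × ℝ) × (ℝ × ℝ) | p.2.2 ∈ segDiff p.1 p.2.1} := by
  let I := Set.Icc (0 : ℝ) 1
  have hK : IsClosed {z : (I × I) × ((ℝ × ℝ) × (ℝ × ℝ) × (ℝ × ℝ)) |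
      (z.1.1 : ℝ) • z.2.1 - (z.1.2 : ℝ) • z.2.2.1 = z.2.2.2} :=
    isClosed_eq (by fun_prop) (by fun_prop)
  convert isClosedMap_snd_of_compactSpace _ hK using 1
  ext p
  simp only [Set.mem_ofPred_eq, mem_segDiff, Set.mem_image]
  constructor
  · rintro ⟨s, hs, t, ht, h⟩
    exact ⟨((⟨s, hs⟩, ⟨t, ht⟩), p), h, rfl⟩
  · rintro ⟨z, h, rfl⟩
    exact ⟨z.1.1, z.1.1.2, z.1.2, z.1.2.2, h⟩

lemma measurableSet_segDiff_of_measurable {Y : Type*} [MeasurableSpace Y] {a b p : Y → ℝ × ℝ}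
    (ha : Measurable a) (hb : Measurable b) (hp : Measurable p) :
    MeasurableSet {y | p y ∈ segDiff (a y) (b y)} :=
  (ha.prodMk (hb.prodMk hp)) isClosed_segDiff.measurableSet

lemma measurableSet_segDiff (a b : ℝ × ℝ) : MeasurableSet (segDiff a b) :=
  measurableSet_segDiff_of_measurable (measurable_const (a := a)) (measurable_const (a := b))
    measurable_id

lemma planeProj_apply (m : ℕ) (x : EuclideanSpace ℝ (Fin (m + 2))) (i : Fin (m + 2)) :
    planeProj (m + 2) x i = if (i : ℕ) < 2 then x i else 0 := by
  have : planeProj (m + 2) x = WithLp.toLp 2 fun i : Fin (m + 2) => if (i : ℕ) < 2 then x i else 0 := by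
    refine (Submodule.eq_starProjection_of_mem_of_inner_eq_zero ?_ ?_)
    · intro i hi
      simp [not_lt.mpr hi]
    · intro w hw
      simp only [PiLp.inner_apply, PiLp.sub_apply]
      refine Finset.sum_eq_zero fun i _ => ?_
      by_cases hi : (i : ℕ) < 2
      · rw [if_pos hi]; simp
      · simp [hw i (not_lt.mp hi)]
  rw [this]

lemma planeProj_eq_iff {m : ℕ} (x y : EuclideanSpace ℝ (Fin (m + 2))) :
    planeProj (m + 2) x = planeProj (m + 2) y ↔ planeCoord m x = planeCoord m y := by
  constructor
  · intro h
    have h0 := congrArg (fun z => z 0) h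
    have h1 := congrArg (fun z => z 1) h
    simp only [planeProj_apply] at h0 h1
    exact Prod.ext (by simpa using h0) (by simpa using h1)
  · intro h
    have h0 : x 0 = y 0 := congrArg Prod.fst h
    have h1 : x 1 = y 1 := congrArg Prod.snd h
    ext i
    simp only [planeProj_apply]
    refine Fin.cases (by simpa using h0) (fun i => Fin.cases (by simpa using h1) (fun i => ?_) i) i
    simp

lemma planeProj_segment_inter_nonempty {m : ℕ} (x y z w : EuclideanSpace ℝ (Fin (m + 2))) :
    ((planeProj (m + 2) '' segment ℝ x y) ∩ (planeProj (m + 2) '' segment ℝ z w)).Nonempty ↔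
      planeCoord m (z - x) ∈ segDiff (planeCoord m (y - x)) (planeCoord m (w - z)) := by
  rw [mem_segDiff, segment_eq_image', segment_eq_image']
  constructor
  · rintro ⟨_, ⟨_, ⟨s, hs, rfl⟩, rfl⟩, ⟨_, ⟨t, ht, rfl⟩, h⟩⟩
    refine ⟨s, hs, t, ht, ?_⟩
    rw [planeProj_eq_iff] at h
    simp only [map_add, map_sub, map_smul] at h ⊢
    rw [sub_eq_sub_iff_add_eq_add, add_comm _ (planeCoord m x), ← h]
  · rintro ⟨s, hs, t, ht, h⟩
    refine ⟨_, ⟨_, ⟨s, hs, rfl⟩, rfl⟩, ⟨_, ⟨t, ht, rfl⟩, ?_⟩⟩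
    rw [planeProj_eq_iff]
    simp only [map_add, map_sub, map_smul] at h ⊢
    rw [sub_eq_sub_iff_add_eq_add, add_comm _ (planeCoord m x)] at h
    exact h.symm

end PlaneCoordinates

section CrossIntegral
open scoped ENNReal

/-- The isometry from the coordinate plane to the Euclidean plane. -/
noncomputable def coordPlaneIsometry (m : ℕ) :
    coordPlane (m + 2) →ₗᵢ[ℝ] EuclideanSpace ℝ (Fin 2) where
  toFun x := !₂[(x : EuclideanSpace ℝ (Fin (m + 2))) 0, (x : EuclideanSpace ℝ (Fin (m + 2))) 1]
  map_add' x y := by ext i; fin_cases i <;> simp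
  map_smul' r x := by ext i; fin_cases i <;> simp
  norm_map' x := by
    rw [← sq_eq_sq₀ (norm_nonneg _) (norm_nonneg _), EuclideanSpace.norm_sq_eq,
      Submodule.coe_norm, norm_sq_eq_planeCoord_add_restCoord]
    have : restCoord m x = 0 := by
      ext i
      exact x.2 i.succ.succ (by simp)
    simp [this, Fin.sum_univ_two]

lemma measurePreserving_planeCoord_coordPlane (m : ℕ) :
    MeasurePreserving (fun x : coordPlane (m + 2) => planeCoord m x) volume volume := by
  have hsurj : Function.Surjective (coordPlaneIsometry m) := by
    intro y
    let x : EuclideanSpace ℝ (Fin (m + 2)) :=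
      WithLp.toLp 2 (Fin.cons (y 0) (Fin.cons (y 1) fun _ => 0))
    have hx : x ∈ coordPlane (m + 2) := by
      intro i hi
      obtain ⟨j, rfl⟩ := Fin.exists_succ_eq.mpr (show i ≠ 0 by rintro rfl; simp at hi)
      obtain ⟨k, rfl⟩ := Fin.exists_succ_eq.mpr (show j ≠ 0 by rintro rfl; simp at hi)
      simp [x]
    refine ⟨⟨x, hx⟩, ?_⟩
    ext i
    fin_cases i
    · rfl
    · rfl
  have h1 := (LinearIsometryEquiv.ofSurjective (coordPlaneIsometry m) hsurj).measurePreserving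
  have h2 := (volume_preserving_finTwoArrow ℝ).comp
    ((PiLp.volume_preserving_ofLp (Fin 2)).comp h1)
  exact h2

/-- The integral of the parallelogram area over pairs of vectors in a ball. -/
noncomputable def crossIntegral (m : ℕ) (r : ℝ) : ℝ≥0∞ :=
  ∫⁻ y in Metric.closedBall (0 : EuclideanSpace ℝ (Fin (m + 2))) r,
    ∫⁻ z in Metric.closedBall (0 : EuclideanSpace ℝ (Fin (m + 2))) r,
      ENNReal.ofReal (planeArea (planeCoord m y) (planeCoord m z))

lemma continuous_planeArea : Continuous fun p : (ℝ × ℝ) × (ℝ × ℝ) => planeArea p.1 p.2 := by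
  unfold planeArea
  fun_prop

lemma measurable_ofReal_planeArea (m : ℕ) :
    Measurable fun p : EuclideanSpace ℝ (Fin (m + 2)) × EuclideanSpace ℝ (Fin (m + 2)) =>
      ENNReal.ofReal (planeArea (planeCoord m p.1) (planeCoord m p.2)) := by
  refine ENNReal.measurable_ofReal.comp ?_
  exact (continuous_planeArea.comp (f := fun p : EuclideanSpace ℝ (Fin (m + 2)) ×
    EuclideanSpace ℝ (Fin (m + 2)) => (planeCoord m p.1, planeCoord m p.2)) (by fun_prop)).measurable

lemma planeArea_smul (r : ℝ) (a b : ℝ × ℝ) : planeArea (r • a) (r • b) = r ^ 2 * planeArea a b := by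
  unfold planeArea
  rw [← abs_of_nonneg (sq_nonneg r), ← abs_mul]
  congr 1
  simp
  ring

lemma setLIntegral_closedBall_eq_smul {m : ℕ} {r : ℝ} (hr : 0 < r)
    (f : EuclideanSpace ℝ (Fin m) → ℝ≥0∞) :
    ∫⁻ y in Metric.closedBall 0 r, f y =
      ENNReal.ofReal (r ^ m) * ∫⁻ y in Metric.closedBall 0 1, f (r • y) := by
  have h := Measure.map_addHaar_smul (volume : Measure (EuclideanSpace ℝ (Fin m))) hr.ne'
  rw [finrank_euclideanSpace_fin] at h
  have he : MeasurableEmbedding (fun y : EuclideanSpace ℝ (Fin m) => r • y) :=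
    (Homeomorph.smulOfNeZero r hr.ne').measurableEmbedding
  have hpre : (fun y : EuclideanSpace ℝ (Fin m) => r • y) ⁻¹' Metric.closedBall 0 r =
      Metric.closedBall 0 1 := by
    ext y
    simp [norm_smul, abs_of_pos hr, hr]
  have h2 := he.lintegral_map (μ := volume.restrict (Metric.closedBall 0 1)) f
  rw [← hpre, ← he.restrict_map, hpre] at h2
  change ∫⁻ y in Metric.closedBall 0 r, f y ∂(volume.map (r • ·)) = _ at h2
  rw [h, Measure.restrict_smul, lintegral_smul_measure] at h2
  rw [← h2, smul_eq_mul, ← mul_assoc, ← ENNReal.ofReal_mul (by positivity),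
    abs_of_pos (by positivity), mul_inv_cancel₀ (by positivity)]
  simp

lemma crossIntegral_eq_mul (m : ℕ) {r : ℝ} (hr : 0 < r) :
    crossIntegral m r = ENNReal.ofReal (r ^ (2 * m + 6)) * crossIntegral m 1 := by
  unfold crossIntegral
  rw [setLIntegral_closedBall_eq_smul hr]
  simp_rw [setLIntegral_closedBall_eq_smul hr, map_smul, planeArea_smul]
  have : ∀ y : EuclideanSpace ℝ (Fin (m + 2)), ∫⁻ z in Metric.closedBall 0 1,
      ENNReal.ofReal (r ^ 2 * planeArea (planeCoord m y) (planeCoord m z)) =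
      ENNReal.ofReal (r ^ 2) * ∫⁻ z in Metric.closedBall 0 1,
        ENNReal.ofReal (planeArea (planeCoord m y) (planeCoord m z)) := by
    intro y
    rw [← lintegral_const_mul' _ _ ENNReal.ofReal_ne_top]
    simp_rw [ENNReal.ofReal_mul (sq_nonneg r)]
  simp_rw [this, ← mul_assoc]
  rw [lintegral_const_mul' _ _ (by finiteness), ← mul_assoc]
  congr 1
  rw [← ENNReal.ofReal_mul (by positivity), ← ENNReal.ofReal_mul (by positivity)]
  ring_nf

lemma crossingConst_eq_crossIntegral (m : ℕ) :
    crossingConst (m + 2) = (crossIntegral m 1).toReal := by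
  classical
  set μ := (volume : Measure (coordPlane (m + 2))).restrict (Metric.closedBall 0 2) with hμ
  set ν := (volume : Measure (EuclideanSpace ℝ (Fin (m + 2)))).restrict (Metric.closedBall 0 1)
    with hν
  let C : Set (coordPlane (m + 2) × EuclideanSpace ℝ (Fin (m + 2)) × EuclideanSpace ℝ (Fin (m + 2))) :=
    {p | planeCoord m p.1 ∈ segDiff (planeCoord m p.2.1) (planeCoord m p.2.2)}
  have hC : MeasurableSet C := by
    refine measurableSet_segDiff_of_measurable ?_ ?_ ?_
    · exact (planeCoord m).measurable.comp (measurable_fst.comp measurable_snd)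
    · exact (planeCoord m).measurable.comp (measurable_snd.comp measurable_snd)
    · exact (measurePreserving_planeCoord_coordPlane m).measurable.comp measurable_fst
  have : IsFiniteMeasure μ := isFiniteMeasure_restrict.mpr measure_closedBall_lt_top.ne
  have : IsFiniteMeasure ν := isFiniteMeasure_restrict.mpr measure_closedBall_lt_top.ne
  have hint : Integrable (C.indicator fun _ => (1 : ℝ)) (μ.prod (ν.prod ν)) :=
    (integrable_const 1).indicator hC
  have hiff : ∀ (w₃ : coordPlane (m + 2)) (w₁ w₂ : EuclideanSpace ℝ (Fin (m + 2))),
      ((planeProj (m + 2) '' segment ℝ 0 w₁) ∩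
          ((fun x => (w₃ : EuclideanSpace ℝ (Fin (m + 2))) + x) ''
            (planeProj (m + 2) '' segment ℝ 0 w₂))).Nonempty ↔ (w₃, w₁, w₂) ∈ C := by
    intro w₃ w₁ w₂
    have himg : ((fun x => (w₃ : EuclideanSpace ℝ (Fin (m + 2))) + x) ''
        (planeProj (m + 2) '' segment ℝ 0 w₂)) =
        planeProj (m + 2) '' segment ℝ (w₃ : EuclideanSpace ℝ (Fin (m + 2))) (w₃ + w₂) := by
      have h3 : planeProj (m + 2) (w₃ : EuclideanSpace ℝ (Fin (m + 2))) = w₃ :=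
        Submodule.starProjection_eq_self_iff.mpr w₃.2
      have h4 := segment_translate_image ℝ (w₃ : EuclideanSpace ℝ (Fin (m + 2))) 0 w₂
      rw [add_zero] at h4
      rw [← h4, Set.image_image, Set.image_image]
      refine Set.image_congr fun x _ => ?_
      nth_rewrite 1 [← h3]
      simp [planeProj]
    rw [himg, planeProj_segment_inter_nonempty]
    simp [C]
  have h1 : crossingConst (m + 2) = ∫ p, C.indicator (fun _ => (1 : ℝ)) p ∂(μ.prod (ν.prod ν)) := by
    rw [integral_prod _ hint]
    refine integral_congr_ae ?_
    filter_upwards [hint.prod_right_ae] with w₃ h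
    rw [integral_prod _ h]
    simp_rw [hiff]
    rfl
  rw [h1, integral_indicator hC, setIntegral_const, smul_eq_mul, mul_one, measureReal_def,
    Measure.prod_apply_symm hC, lintegral_prod _
      (measurable_measure_prodMk_right hC).aemeasurable, crossIntegral]
  congr 1
  refine setLIntegral_congr_fun Metric.isClosed_closedBall.measurableSet fun y hy => ?_
  refine setLIntegral_congr_fun Metric.isClosed_closedBall.measurableSet fun z hz => ?_
  have hpre : (fun w₃ : coordPlane (m + 2) => (w₃, y, z)) ⁻¹' C =
      (fun w : coordPlane (m + 2) => planeCoord m w) ⁻¹'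
        segDiff (planeCoord m y) (planeCoord m z) := rfl
  have hsub : (fun w : coordPlane (m + 2) => planeCoord m w) ⁻¹'
        segDiff (planeCoord m y) (planeCoord m z) ⊆ Metric.closedBall 0 2 := by
    intro w hw
    obtain ⟨s, hs, t, ht, h⟩ := mem_segDiff.mp hw
    have hrest : restCoord m w = 0 := by
      ext i
      exact w.2 i.succ.succ (by simp)
    have h5 : ‖w‖ ^ 2 ≤ ‖s • y - t • z‖ ^ 2 := by
      rw [Submodule.coe_norm, norm_sq_eq_planeCoord_add_restCoord,
        norm_sq_eq_planeCoord_add_restCoord (s • y - t • z), hrest]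
      simp only at h
      rw [← h, map_sub, map_smul, map_smul]
      simp
    have h6 := (sq_le_sq₀ (norm_nonneg _) (norm_nonneg _)).mp h5
    rw [mem_closedBall_zero_iff] at hy hz ⊢
    calc ‖w‖ ≤ ‖s • y‖ + ‖t • z‖ := h6.trans (norm_sub_le _ _)
      _ ≤ 1 + 1 := by
        rw [norm_smul, norm_smul, Real.norm_of_nonneg hs.1, Real.norm_of_nonneg ht.1]
        exact add_le_add (mul_le_one₀ hs.2 (norm_nonneg _) hy)
          (mul_le_one₀ ht.2 (norm_nonneg _) hz)
      _ = 2 := by norm_num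
  change μ ((fun w₃ : coordPlane (m + 2) => (w₃, y, z)) ⁻¹' C) = _
  rw [hpre, hμ, Measure.restrict_apply' Metric.isClosed_closedBall.measurableSet,
    Set.inter_eq_left.mpr hsub, (measurePreserving_planeCoord_coordPlane m).measure_preimage
      (measurableSet_segDiff _ _).nullMeasurableSet, volume_segDiff]

/-- The measure of the set of points with given last coordinates whose first two coordinates lie
in a translated parallelogram. -/
lemma volume_planeCoord_sub_mem_segDiff (m : ℕ) (a b p : ℝ × ℝ)
    {A : Set (EuclideanSpace ℝ (Fin m))} (hA : MeasurableSet A) :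
    volume {z | restCoord m z ∈ A ∧ planeCoord m z - p ∈ segDiff a b} =
      volume A * ENNReal.ofReal (planeArea a b) := by
  have hS : MeasurableSet ((fun x : ℝ × ℝ => x - p) ⁻¹' segDiff a b) :=
    (measurable_id.sub_const p) (measurableSet_segDiff a b)
  have hsub : volume ((fun x : ℝ × ℝ => x - p) ⁻¹' segDiff a b) = volume (segDiff a b) := by
    simp_rw [sub_eq_add_neg]
    exact measure_preimage_add_right _ _ _
  have h := (measurePreserving_planeCoord_restCoord m).measure_preimage
    (hS.prod hA).nullMeasurableSet
  rw [Measure.volume_eq_prod, Measure.prod_prod, hsub, volume_segDiff,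
    mul_comm] at h
  rw [← h]
  congr 1
  ext z
  simp [and_comm]

/-- The triples `(x, z, w)` such that the edges `vx` and `zw` of length at most `r` cross. -/
def crossingTriples (m : ℕ) (r : ℝ) (v : EuclideanSpace ℝ (Fin (m + 2))) :
    Set (EuclideanSpace ℝ (Fin (m + 2)) × EuclideanSpace ℝ (Fin (m + 2)) ×
      EuclideanSpace ℝ (Fin (m + 2))) :=
  {p | ‖v - p.1‖ ≤ r ∧ ‖p.2.1 - p.2.2‖ ≤ r ∧
    planeCoord m (p.2.1 - v) ∈ segDiff (planeCoord m (p.1 - v)) (planeCoord m (p.2.2 - p.2.1))}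

lemma measurable_restCoord (m : ℕ) : Measurable (restCoord m) :=
  measurable_snd.comp (measurePreserving_planeCoord_restCoord m).measurable

lemma mem_crossingTriples_add {m : ℕ} {r : ℝ} {v y z w : EuclideanSpace ℝ (Fin (m + 2))} :
    (v + y, z, z + w) ∈ crossingTriples m r v ↔
      y ∈ Metric.closedBall 0 r ∧ w ∈ Metric.closedBall 0 r ∧
        planeCoord m z - planeCoord m v ∈ segDiff (planeCoord m y) (planeCoord m w) := by
  simp [crossingTriples]

lemma measurableSet_planeCoord_sub_mem_segDiff (m : ℕ) (y v : EuclideanSpace ℝ (Fin (m + 2))) :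
    MeasurableSet {p : EuclideanSpace ℝ (Fin (m + 2)) × EuclideanSpace ℝ (Fin (m + 2)) |
      planeCoord m p.1 - planeCoord m v ∈ segDiff (planeCoord m y) (planeCoord m p.2)} := by
  have h1 : Measurable fun p : EuclideanSpace ℝ (Fin (m + 2)) × EuclideanSpace ℝ (Fin (m + 2)) =>
      planeCoord m p.2 := ((planeCoord m).continuous.comp continuous_snd).measurable
  have h2 : Measurable fun p : EuclideanSpace ℝ (Fin (m + 2)) × EuclideanSpace ℝ (Fin (m + 2)) =>
      planeCoord m p.1 - planeCoord m v :=
    (((planeCoord m).continuous.comp continuous_fst).sub continuous_const).measurable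
  exact measurableSet_segDiff_of_measurable (measurable_const (a := planeCoord m y)) h1 h2

lemma lintegral_slab_of_norm_le (m : ℕ) {r : ℝ} (v : EuclideanSpace ℝ (Fin (m + 2)))
    {A : Set (EuclideanSpace ℝ (Fin m))} (hA : MeasurableSet A)
    {y : EuclideanSpace ℝ (Fin (m + 2))} (hy : y ∈ Metric.closedBall 0 r) :
    ∫⁻ z in restCoord m ⁻¹' A, ∫⁻ w,
        (crossingTriples m r v).indicator (fun _ => (1 : ℝ≥0∞)) (v + y, z, w) =
      volume A * ∫⁻ w in Metric.closedBall 0 r,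
        ENNReal.ofReal (planeArea (planeCoord m y) (planeCoord m w)) := by
  have hB : MeasurableSet (Metric.closedBall (0 : EuclideanSpace ℝ (Fin (m + 2))) r) :=
    Metric.isClosed_closedBall.measurableSet
  have hmy : Measurable fun w => ENNReal.ofReal (planeArea (planeCoord m y) (planeCoord m w)) := by
    have := (measurable_ofReal_planeArea m).comp (measurable_prodMk_left (x := y))
    exact this
  let T : Set (EuclideanSpace ℝ (Fin (m + 2)) × EuclideanSpace ℝ (Fin (m + 2))) :=
    {p | planeCoord m p.1 - planeCoord m v ∈ segDiff (planeCoord m y) (planeCoord m p.2)}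
  have hT : MeasurableSet T := measurableSet_planeCoord_sub_mem_segDiff m y v
  have h1 : ∀ z, ∫⁻ w, (crossingTriples m r v).indicator (fun _ => (1 : ℝ≥0∞)) (v + y, z, w) =
      ∫⁻ w in Metric.closedBall 0 r, T.indicator (fun _ => (1 : ℝ≥0∞)) (z, w) := by
    intro z
    rw [← lintegral_add_left_eq_self _ z, ← lintegral_indicator hB]
    refine lintegral_congr fun w => ?_
    have key : (v + y, z, z + w) ∈ crossingTriples m r v ↔
        w ∈ Metric.closedBall 0 r ∧ (z, w) ∈ T :=
      mem_crossingTriples_add.trans (and_iff_right hy)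
    by_cases hw : w ∈ Metric.closedBall 0 r
    · by_cases hzw : (z, w) ∈ T
      · rw [Set.indicator_of_mem (key.mpr ⟨hw, hzw⟩), Set.indicator_of_mem hw,
          Set.indicator_of_mem hzw]
      · rw [Set.indicator_of_notMem fun h => hzw (key.mp h).2, Set.indicator_of_mem hw,
          Set.indicator_of_notMem hzw]
    · rw [Set.indicator_of_notMem fun h => hw (key.mp h).1, Set.indicator_of_notMem hw]
  simp_rw [h1]
  have hTm : Measurable (T.indicator fun _ => (1 : ℝ≥0∞)) := measurable_const.indicator hT
  rw [lintegral_lintegral_swap (f := fun z w => T.indicator (fun _ => (1 : ℝ≥0∞)) (z, w))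
    hTm.aemeasurable,
    ← lintegral_const_mul _ hmy]
  refine lintegral_congr fun w => ?_
  rw [← volume_planeCoord_sub_mem_segDiff m _ _ (planeCoord m v) hA]
  have h2 := lintegral_indicator_one (μ := volume.restrict (restCoord m ⁻¹' A))
    (measurable_prodMk_right (y := w) hT)
  refine h2.trans ?_
  rw [Measure.restrict_apply (measurable_prodMk_right hT), Set.inter_comm]
  rfl

/-- The crossings of an edge at `v` with edges in a slab. -/
lemma lintegral_slab (m : ℕ) (r : ℝ) (v : EuclideanSpace ℝ (Fin (m + 2)))
    {A : Set (EuclideanSpace ℝ (Fin m))} (hA : MeasurableSet A) :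
    ∫⁻ x, ∫⁻ z in restCoord m ⁻¹' A, ∫⁻ w,
        (crossingTriples m r v).indicator (fun _ => (1 : ℝ≥0∞)) (x, z, w) =
      volume A * crossIntegral m r := by
  have hB : MeasurableSet (Metric.closedBall (0 : EuclideanSpace ℝ (Fin (m + 2))) r) :=
    Metric.isClosed_closedBall.measurableSet
  rw [← lintegral_add_left_eq_self _ v, crossIntegral,
    ← lintegral_const_mul _ (measurable_ofReal_planeArea m).lintegral_prod_right',
    ← lintegral_indicator hB]
  refine lintegral_congr fun y => ?_
  by_cases hy : y ∈ Metric.closedBall (0 : EuclideanSpace ℝ (Fin (m + 2))) r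
  · rw [Set.indicator_of_mem hy]
    exact lintegral_slab_of_norm_le m v hA hy
  · rw [Set.indicator_of_notMem hy]
    have : ∀ z w, (crossingTriples m r v).indicator (fun _ => (1 : ℝ≥0∞)) (v + y, z, w) = 0 := by
      intro z w
      refine Set.indicator_of_notMem (fun h => hy ?_) _
      simpa [crossingTriples] using h.1
    simp [this]

end CrossIntegral

section CrossIntegralValue
open scoped ENNReal

lemma lintegral_polarCoord {F : ℝ × ℝ → ℝ≥0∞} (hF : Measurable F) :
    ∫⁻ p, F p = ∫⁻ r in Set.Ioi (0 : ℝ), ∫⁻ θ in Set.Ioo (-Real.pi) Real.pi,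
      ENNReal.ofReal r * F (r * Real.cos θ, r * Real.sin θ) := by
  rw [← lintegral_comp_polarCoord_symm, polarCoord_target, Measure.volume_eq_prod,
    ← Measure.prod_restrict, lintegral_prod]
  · rfl
  · refine Measurable.aemeasurable ?_
    refine Measurable.mul (by fun_prop) (hF.comp ?_)
    exact continuous_polarCoord_symm.measurable

lemma lintegral_abs_sin_sub (α : ℝ) :
    ∫⁻ θ in Set.Ioo (-Real.pi) Real.pi,
      ENNReal.ofReal |Real.cos α * Real.sin θ - Real.sin α * Real.cos θ| = 4 := by
  have hc : Continuous fun θ => |Real.cos α * Real.sin θ - Real.sin α * Real.cos θ| := by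
    fun_prop
  have hint : ∀ a b : ℝ, IntervalIntegrable (fun θ => |Real.sin θ|) volume a b := fun a b =>
    (Real.continuous_sin.abs).intervalIntegrable a b
  rw [restrict_Ioo_eq_restrict_Ioc, ← ofReal_integral_eq_lintegral_ofReal
    (hc.integrableOn_Ioc) (ae_of_all _ fun _ => abs_nonneg _),
    ← intervalIntegral.integral_of_le (by linarith [Real.pi_pos])]
  have h1 : ∫ θ in (-Real.pi)..Real.pi, |Real.cos α * Real.sin θ - Real.sin α * Real.cos θ| =
      ∫ θ in (-Real.pi)..Real.pi, |Real.sin (θ - α)| := by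
    congr 1
    ext θ
    rw [Real.sin_sub]
    ring_nf
  have hper : Function.Periodic (fun θ => |Real.sin θ|) (2 * Real.pi) := fun θ => by
    simp
  have h2 : ∫ θ in (-Real.pi)..Real.pi, |Real.sin (θ - α)| =
      ∫ θ in (-Real.pi)..Real.pi, |Real.sin θ| := by
    rw [intervalIntegral.integral_comp_sub_right (fun θ => |Real.sin θ|)]
    have := hper.intervalIntegral_add_eq (-Real.pi - α) (-Real.pi)
    convert this using 2 <;> ring
  have h3 : ∫ θ in (0 : ℝ)..Real.pi, |Real.sin θ| = 2 := by
    rw [intervalIntegral.integral_congr (g := Real.sin)]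
    · rw [integral_sin]
      norm_num
    · intro θ hθ
      rw [Set.uIcc_of_le Real.pi_pos.le] at hθ
      exact abs_of_nonneg (Real.sin_nonneg_of_mem_Icc hθ)
  have h4 : ∫ θ in (-Real.pi)..0, |Real.sin θ| = 2 := by
    have := intervalIntegral.integral_comp_neg (fun θ => |Real.sin θ|) (a := 0) (b := Real.pi)
    simp only [Real.sin_neg, abs_neg, neg_zero] at this
    rw [← this, h3]
  rw [h1, h2, ← intervalIntegral.integral_add_adjacent_intervals (hint _ 0) (hint _ _), h3, h4]
  norm_num

/-- The density of the projection of the uniform distribution on the unit ball to the plane. -/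
noncomputable def radialDensity (m : ℕ) (ρ : ℝ) : ℝ≥0∞ :=
  (Set.Iic (1 : ℝ)).indicator
    (fun s => ENNReal.ofReal (unitBallVolume m * √(1 - s) ^ m)) (ρ ^ 2)

lemma measurable_radialDensity (m : ℕ) : Measurable (radialDensity m) := by
  unfold radialDensity
  refine Measurable.comp (g := (Set.Iic (1 : ℝ)).indicator
    (fun s => ENNReal.ofReal (unitBallVolume m * √(1 - s) ^ m))) ?_ (by fun_prop)
  exact Measurable.indicator (by fun_prop) measurableSet_Iic

lemma volume_norm_sq_le (m : ℕ) (ρ : ℝ) :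
    volume {u : EuclideanSpace ℝ (Fin m) | ρ ^ 2 + ‖u‖ ^ 2 ≤ 1} = radialDensity m ρ := by
  unfold radialDensity
  by_cases h : ρ ^ 2 ≤ 1
  · rw [Set.indicator_of_mem (Set.mem_Iic.mpr h)]
    have : {u : EuclideanSpace ℝ (Fin m) | ρ ^ 2 + ‖u‖ ^ 2 ≤ 1} =
        Metric.closedBall 0 (√(1 - ρ ^ 2)) := by
      ext u
      rw [mem_closedBall_zero_iff, Real.le_sqrt (norm_nonneg _) (by linarith)]
      simp only [Set.mem_ofPred_eq]
      constructor <;> intro h <;> linarith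
    rw [this, Measure.addHaar_closedBall' _ _ (Real.sqrt_nonneg _), finrank_euclideanSpace_fin,
      mul_comm (unitBallVolume m), ENNReal.ofReal_mul (by positivity), unitBallVolume,
      ofReal_measureReal measure_closedBall_lt_top.ne]
  · rw [Set.indicator_of_notMem (by simpa using h)]
    have : {u : EuclideanSpace ℝ (Fin m) | ρ ^ 2 + ‖u‖ ^ 2 ≤ 1} = ∅ := by
      ext u
      simp only [Set.mem_ofPred_eq, Set.mem_empty_iff_false, iff_false]
      nlinarith [sq_nonneg ‖u‖]
    rw [this, measure_empty]

lemma setLIntegral_closedBall_planeCoord (m : ℕ) {g : ℝ × ℝ → ℝ≥0∞} (hg : Measurable g) :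
    ∫⁻ y in Metric.closedBall (0 : EuclideanSpace ℝ (Fin (m + 2))) 1, g (planeCoord m y) =
      ∫⁻ p : ℝ × ℝ, g p * radialDensity m (√(p.1 ^ 2 + p.2 ^ 2)) := by
  let S : Set ((ℝ × ℝ) × EuclideanSpace ℝ (Fin m)) :=
    {z | z.1.1 ^ 2 + z.1.2 ^ 2 + ‖z.2‖ ^ 2 ≤ 1}
  have hS : MeasurableSet S := (isClosed_le (by fun_prop) (by fun_prop)).measurableSet
  have hm : Measurable (S.indicator fun z => g z.1) := (hg.comp measurable_fst).indicator hS
  rw [← lintegral_indicator Metric.isClosed_closedBall.measurableSet]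
  have h1 : ∀ y, (Metric.closedBall (0 : EuclideanSpace ℝ (Fin (m + 2))) 1).indicator
      (fun y => g (planeCoord m y)) y =
      S.indicator (fun z => g z.1) (planeCoord m y, restCoord m y) := by
    intro y
    have : y ∈ Metric.closedBall (0 : EuclideanSpace ℝ (Fin (m + 2))) 1 ↔
        (planeCoord m y, restCoord m y) ∈ S := by
      rw [mem_closedBall_zero_iff, ← sq_le_one_iff₀ (norm_nonneg _),
        norm_sq_eq_planeCoord_add_restCoord]
      rfl
    by_cases hy : y ∈ Metric.closedBall (0 : EuclideanSpace ℝ (Fin (m + 2))) 1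
    · rw [Set.indicator_of_mem hy, Set.indicator_of_mem (this.mp hy)]
    · rw [Set.indicator_of_notMem hy, Set.indicator_of_notMem fun h => hy (this.mpr h)]
  simp_rw [h1]
  rw [(measurePreserving_planeCoord_restCoord m).lintegral_comp hm, Measure.volume_eq_prod,
    lintegral_prod _ hm.aemeasurable]
  refine lintegral_congr fun p => ?_
  have h2 : MeasurableSet (Prod.mk p ⁻¹' S) := measurable_prodMk_left hS
  have h3 : ∀ u, S.indicator (fun z => g z.1) (p, u) =
      (Prod.mk p ⁻¹' S).indicator (fun _ => g p) u := fun u => rfl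
  simp_rw [h3]
  rw [lintegral_indicator h2, setLIntegral_const, ← volume_norm_sq_le,
    Real.sq_sqrt (by positivity)]
  rfl

/-- The first moment of the radial density. -/
noncomputable def radialMoment (m : ℕ) : ℝ≥0∞ :=
  ∫⁻ r in Set.Ioi (0 : ℝ), ENNReal.ofReal (r ^ 2) * radialDensity m r

lemma measurable_sq_mul_radialDensity (m : ℕ) :
    Measurable fun r : ℝ => ENNReal.ofReal (r ^ 2) * radialDensity m r :=
  (by fun_prop : Measurable fun r : ℝ => ENNReal.ofReal (r ^ 2)).mul (measurable_radialDensity m)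

lemma sqrt_polar {r : ℝ} (hr : 0 < r) (θ : ℝ) :
    √((r * Real.cos θ) ^ 2 + (r * Real.sin θ) ^ 2) = r := by
  rw [mul_pow, mul_pow, ← mul_add, Real.cos_sq_add_sin_sq, mul_one, Real.sqrt_sq hr.le]

lemma lintegral_planeArea_radialDensity (m : ℕ) {s : ℝ} (hs : 0 < s) (α : ℝ) :
    ∫⁻ p : ℝ × ℝ, ENNReal.ofReal (planeArea (s * Real.cos α, s * Real.sin α) p) *
      radialDensity m (√(p.1 ^ 2 + p.2 ^ 2)) = ENNReal.ofReal s * 4 * radialMoment m := by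
  have hm : Measurable fun p : ℝ × ℝ =>
      ENNReal.ofReal (planeArea (s * Real.cos α, s * Real.sin α) p) *
      radialDensity m (√(p.1 ^ 2 + p.2 ^ 2)) := by
    refine Measurable.mul ?_ ((measurable_radialDensity m).comp (by fun_prop))
    unfold planeArea
    fun_prop
  rw [lintegral_polarCoord hm, radialMoment,
    ← lintegral_const_mul _ (measurable_sq_mul_radialDensity m)]
  refine setLIntegral_congr_fun measurableSet_Ioi fun r hr => ?_
  have hr : 0 < r := hr
  simp only [sqrt_polar hr]
  rw [← lintegral_abs_sin_sub α]
  have h1 : ∀ θ, ENNReal.ofReal r * (ENNReal.ofReal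
      (planeArea (s * Real.cos α, s * Real.sin α) (r * Real.cos θ, r * Real.sin θ)) *
        radialDensity m r) =
      (ENNReal.ofReal s * (ENNReal.ofReal (r ^ 2) * radialDensity m r)) *
        ENNReal.ofReal |Real.cos α * Real.sin θ - Real.sin α * Real.cos θ| := by
    intro θ
    have : planeArea (s * Real.cos α, s * Real.sin α) (r * Real.cos θ, r * Real.sin θ) =
        s * r * |Real.cos α * Real.sin θ - Real.sin α * Real.cos θ| := by
      rw [planeArea, ← abs_of_pos (mul_pos hs hr), ← abs_mul]
      ring_nf
    rw [this, ENNReal.ofReal_mul (by positivity), ENNReal.ofReal_mul hs.le, sq,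
      ENNReal.ofReal_mul hr.le]
    ring
  simp_rw [h1]
  rw [lintegral_const_mul _ (by fun_prop)]
  ring

lemma crossIntegral_one_eq_radialMoment (m : ℕ) :
    crossIntegral m 1 = ENNReal.ofReal (8 * Real.pi) * radialMoment m ^ 2 := by
  have hmA : ∀ y : ℝ × ℝ, Measurable fun p => ENNReal.ofReal (planeArea y p) := by
    intro y
    unfold planeArea
    fun_prop
  have hmJ : Measurable fun y : ℝ × ℝ => ∫⁻ p : ℝ × ℝ, ENNReal.ofReal (planeArea y p) *
      radialDensity m (√(p.1 ^ 2 + p.2 ^ 2)) := by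
    refine Measurable.lintegral_prod_right' (f := fun z : (ℝ × ℝ) × (ℝ × ℝ) =>
      ENNReal.ofReal (planeArea z.1 z.2) * radialDensity m (√(z.2.1 ^ 2 + z.2.2 ^ 2))) ?_
    exact (ENNReal.measurable_ofReal.comp continuous_planeArea.measurable).mul
      ((measurable_radialDensity m).comp (by fun_prop))
  rw [crossIntegral]
  simp_rw [fun y => setLIntegral_closedBall_planeCoord m (hmA (planeCoord m y))]
  have hmR : Measurable fun y : ℝ × ℝ => radialDensity m (√(y.1 ^ 2 + y.2 ^ 2)) :=
    (measurable_radialDensity m).comp (by fun_prop)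
  have hmJR : Measurable fun y : ℝ × ℝ => (∫⁻ p : ℝ × ℝ, ENNReal.ofReal (planeArea y p) *
      radialDensity m (√(p.1 ^ 2 + p.2 ^ 2))) * radialDensity m (√(y.1 ^ 2 + y.2 ^ 2)) :=
    hmJ.mul hmR
  rw [setLIntegral_closedBall_planeCoord m hmJ, lintegral_polarCoord hmJR]
  have h1 : ∀ r ∈ Set.Ioi (0 : ℝ), ∫⁻ θ in Set.Ioo (-Real.pi) Real.pi, ENNReal.ofReal r *
      ((∫⁻ p : ℝ × ℝ, ENNReal.ofReal (planeArea (r * Real.cos θ, r * Real.sin θ) p) *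
        radialDensity m (√(p.1 ^ 2 + p.2 ^ 2))) *
        radialDensity m (√((r * Real.cos θ) ^ 2 + (r * Real.sin θ) ^ 2))) =
      (ENNReal.ofReal (8 * Real.pi) * radialMoment m) *
        (ENNReal.ofReal (r ^ 2) * radialDensity m r) := by
    intro r hr
    have hr : 0 < r := hr
    simp_rw [lintegral_planeArea_radialDensity m hr, sqrt_polar hr]
    rw [setLIntegral_const, Real.volume_Ioo, sq, ENNReal.ofReal_mul hr.le,
      show 8 * Real.pi = 4 * (Real.pi - -Real.pi) by ring, ENNReal.ofReal_mul (by norm_num)]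
    rw [show ENNReal.ofReal 4 = 4 by norm_num]
    ring
  rw [setLIntegral_congr_fun measurableSet_Ioi h1, lintegral_const_mul _
    (measurable_sq_mul_radialDensity m), ← radialMoment]
  ring

lemma radialMoment_eq (m : ℕ) :
    radialMoment m =
      ENNReal.ofReal (unitBallVolume m / 2 * beta (3 / 2) (((m + 2 : ℕ) : ℝ) / 2)) := by
  have hb : 0 < beta (3 / 2) (((m + 2 : ℕ) : ℝ) / 2) := beta_pos (by norm_num) (by positivity)
  have hk : 0 ≤ unitBallVolume m := measureReal_nonneg
  have h0 : radialMoment m =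
      ∫⁻ r in Set.Ioo (0 : ℝ) 1, ENNReal.ofReal (r ^ 2) * radialDensity m r := by
    rw [radialMoment, ← Set.Ioc_union_Ioi_eq_Ioi zero_le_one,
      lintegral_union measurableSet_Ioi (Set.Ioc_disjoint_Ioi le_rfl),
      restrict_Ioo_eq_restrict_Ioc, setLIntegral_congr_fun measurableSet_Ioi (g := fun _ => 0)]
    · simp
    · intro r hr
      have hr : 1 < r := hr
      have : r ^ 2 ∉ Set.Iic (1 : ℝ) := by
        rw [Set.mem_Iic]
        nlinarith
      simp [radialDensity, this]
  have himg : (fun x : ℝ => x ^ 2) '' Set.Ioo 0 1 = Set.Ioo 0 1 := by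
    ext y
    constructor
    · rintro ⟨x, ⟨hx0, hx1⟩, rfl⟩
      exact ⟨by positivity, by simp only; nlinarith⟩
    · rintro ⟨hy0, hy1⟩
      exact ⟨√y, ⟨Real.sqrt_pos.mpr hy0, by rw [Real.sqrt_lt' one_pos]; simpa using hy1⟩,
        Real.sq_sqrt hy0.le⟩
  have h1 := lintegral_betaPDF_eq_one (α := 3 / 2) (β := ((m + 2 : ℕ) : ℝ) / 2)
    (by norm_num) (by positivity)
  rw [lintegral_betaPDF, ← himg, lintegral_image_eq_lintegral_abs_deriv_mul (f' := fun x => 2 * x)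
    measurableSet_Ioo (fun x _ => by simpa using (hasDerivAt_pow 2 x).hasDerivWithinAt)
    (fun x hx y hy h => (pow_left_inj₀ hx.1.le hy.1.le two_ne_zero).mp h)] at h1
  rw [h0, ← mul_one (ENNReal.ofReal (unitBallVolume m / 2 * _)), ← h1,
    ← lintegral_const_mul' _ _ ENNReal.ofReal_ne_top]
  refine setLIntegral_congr_fun measurableSet_Ioo fun r hr => ?_
  have hr0 : 0 < r := hr.1
  have hr1 : r ^ 2 ∈ Set.Iic (1 : ℝ) := by
    rw [Set.mem_Iic]
    nlinarith [hr.2]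
  have hr2 : (0 : ℝ) ≤ 1 - r ^ 2 := sub_nonneg.mpr hr1
  have e1 : (r ^ 2) ^ ((3 : ℝ) / 2 - 1) = r := by
    rw [show (3 : ℝ) / 2 - 1 = 1 / 2 by norm_num, ← Real.sqrt_eq_rpow, Real.sqrt_sq hr0.le]
  have e2 : (1 - r ^ 2) ^ (((m + 2 : ℕ) : ℝ) / 2 - 1) = √(1 - r ^ 2) ^ m := by
    rw [Real.sqrt_eq_rpow, ← Real.rpow_natCast _ m, ← Real.rpow_mul hr2]
    congr 1
    push_cast
    ring
  rw [radialDensity, Set.indicator_of_mem hr1, e1, e2, ← ENNReal.ofReal_mul (by positivity),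
    ← ENNReal.ofReal_mul (by positivity), ← ENNReal.ofReal_mul (by positivity),
    abs_of_pos (by positivity)]
  congr 1
  field_simp

theorem crossIntegral_one (m : ℕ) :
    crossIntegral m 1 = ENNReal.ofReal
      (2 * Real.pi * unitBallVolume m ^ 2 * beta (3 / 2) (((m + 2 : ℕ) : ℝ) / 2) ^ 2) := by
  have hb : 0 < beta (3 / 2) (((m + 2 : ℕ) : ℝ) / 2) := beta_pos (by norm_num) (by positivity)
  have hk : 0 ≤ unitBallVolume m := measureReal_nonneg
  rw [crossIntegral_one_eq_radialMoment, radialMoment_eq, ← ENNReal.ofReal_pow (by positivity),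
    ← ENNReal.ofReal_mul (by positivity)]
  congr 1
  ring

end CrossIntegralValue

section CrossingBounds
open scoped ENNReal

/-- A cube with sides parallel to the axes. -/
def axisBox (n : ℕ) (a b : ℝ) : Set (EuclideanSpace ℝ (Fin n)) :=
  {x | ∀ i, x i ∈ Set.Icc a b}

lemma unitCube_eq_axisBox (n : ℕ) : unitCube n = axisBox n 0 1 := rfl

lemma isClosed_axisBox (n : ℕ) (a b : ℝ) : IsClosed (axisBox n a b) := by
  have : axisBox n a b = ⋂ i, {x | x i ∈ Set.Icc a b} := by
    ext x; simp [axisBox]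
  rw [this]
  exact isClosed_iInter fun i => isClosed_Icc.preimage (by fun_prop)

lemma measurableSet_axisBox (n : ℕ) (a b : ℝ) : MeasurableSet (axisBox n a b) :=
  (isClosed_axisBox n a b).measurableSet

lemma volume_axisBox (n : ℕ) (a b : ℝ) : volume (axisBox n a b) = ENNReal.ofReal (b - a) ^ n := by
  have h := (PiLp.volume_preserving_ofLp (Fin n)).measure_preimage
    (MeasurableSet.univ_pi fun _ : Fin n => measurableSet_Icc (a := a) (b := b)).nullMeasurableSet
  rw [volume_pi_pi] at h
  simp only [Real.volume_Icc, Finset.prod_const, Finset.card_univ, Fintype.card_fin] at h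
  rw [← h]
  congr 1
  ext x
  simp only [axisBox, Set.mem_ofPred_eq, Set.mem_preimage, Set.mem_univ_pi]

lemma measurableSet_unitCube (n : ℕ) : MeasurableSet (unitCube n) := measurableSet_axisBox n 0 1

lemma volume_unitCube (n : ℕ) : volume (unitCube n) = 1 := by
  rw [unitCube_eq_axisBox, volume_axisBox]
  simp

lemma convex_unitCube (n : ℕ) : Convex ℝ (unitCube n) := by
  have : unitCube n = ⋂ i, (fun x : EuclideanSpace ℝ (Fin n) => x i) ⁻¹' Set.Icc 0 1 := by
    ext x; simp [unitCube]
  rw [this]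
  exact convex_iInter fun i => (convex_Icc 0 1).is_linear_preimage ⟨by simp, by simp⟩

instance (n : ℕ) : IsProbabilityMeasure
    ((volume : Measure (EuclideanSpace ℝ (Fin n))).restrict (unitCube n)) :=
  ⟨by rw [Measure.restrict_apply_univ, volume_unitCube]⟩

/-- The quadruples `(v₁, v₂, w₁, w₂)` such that the edges `v₁v₂` and `w₁w₂` of length at most `r`
have crossing projections. -/
def crossingSet (m : ℕ) (r : ℝ) : Set (Fin 4 → EuclideanSpace ℝ (Fin (m + 2))) :=
  {x | (x 1, x 2, x 3) ∈ crossingTriples m r (x 0)}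

lemma measurableSet_crossingSet (m : ℕ) (r : ℝ) : MeasurableSet (crossingSet m r) := by
  have h1 : MeasurableSet {x : Fin 4 → EuclideanSpace ℝ (Fin (m + 2)) | ‖x 0 - x 1‖ ≤ r} :=
    (isClosed_le (by fun_prop) (by fun_prop)).measurableSet
  have h2 : MeasurableSet {x : Fin 4 → EuclideanSpace ℝ (Fin (m + 2)) | ‖x 2 - x 3‖ ≤ r} :=
    (isClosed_le (by fun_prop) (by fun_prop)).measurableSet
  have hp : ∀ i j : Fin 4, Measurable fun x : Fin 4 → EuclideanSpace ℝ (Fin (m + 2)) =>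
      planeCoord m (x i - x j) := fun i j =>
    ((planeCoord m).continuous.comp ((continuous_apply i).sub (continuous_apply j))).measurable
  exact h1.inter (h2.inter (measurableSet_segDiff_of_measurable (hp 1 0) (hp 3 2) (hp 2 0)))

lemma mem_crossingQuadruples_iff {m : ℕ} {r : ℝ} {x : Fin 4 → EuclideanSpace ℝ (Fin (m + 2))}
    (hx : ∀ i, x i ∈ unitCube (m + 2)) :
    x ∈ crossingQuadruples (m + 2) r (planeProj (m + 2) '' unitCube (m + 2)) ↔
      x ∈ crossingSet m r := by
  have h : (planeProj (m + 2) '' segment ℝ (x 0) (x 1)) ∩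
      (planeProj (m + 2) '' segment ℝ (x 2) (x 3)) ∩ (planeProj (m + 2) '' unitCube (m + 2)) =
      (planeProj (m + 2) '' segment ℝ (x 0) (x 1)) ∩
      (planeProj (m + 2) '' segment ℝ (x 2) (x 3)) :=
    Set.inter_eq_left.mpr (Set.inter_subset_left.trans
      (Set.image_mono ((convex_unitCube _).segment_subset (hx 0) (hx 1))))
  rw [crossingQuadruples, Set.mem_ofPred_eq, h, planeProj_segment_inter_nonempty]
  rfl

lemma abs_apply_le_norm {n : ℕ} (x : EuclideanSpace ℝ (Fin n)) (i : Fin n) : |x i| ≤ ‖x‖ :=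
  PiLp.norm_apply_le x i

lemma crossingTriples_subset {m : ℕ} {r : ℝ} {v x z w : EuclideanSpace ℝ (Fin (m + 2))}
    (hv : v ∈ axisBox (m + 2) (4 * r) (1 - 4 * r)) (h : (x, z, w) ∈ crossingTriples m r v)
    (hz : restCoord m z ∈ axisBox m r (1 - r)) :
    x ∈ unitCube (m + 2) ∧ z ∈ unitCube (m + 2) ∧ w ∈ unitCube (m + 2) := by
  obtain ⟨h1, h2, h3⟩ := h
  simp only at h1 h2 h3
  have hr : 0 ≤ r := (norm_nonneg _).trans h1
  have hx : ∀ i, |v i - x i| ≤ r := fun i => (abs_apply_le_norm (v - x) i).trans h1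
  have hw : ∀ i, |z i - w i| ≤ r := fun i => (abs_apply_le_norm (z - w) i).trans h2
  obtain ⟨s, hs, t, ht, h4⟩ := mem_segDiff.mp h3
  have key : ∀ i, z i - v i = s * (x i - v i) - t * (w i - z i) → |z i - v i| ≤ 2 * r := by
    intro i hi
    rw [hi]
    refine (abs_sub _ _).trans ?_
    rw [abs_mul, abs_mul, abs_of_nonneg hs.1, abs_of_nonneg ht.1, abs_sub_comm (x i),
      abs_sub_comm (w i)]
    nlinarith [hx i, hw i, abs_nonneg (v i - x i), abs_nonneg (z i - w i), hs.1, hs.2, ht.1, ht.2]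
  have hz' : ∀ i, z i ∈ Set.Icc r (1 - r) := by
    intro i
    refine Fin.cases ?_ (fun i => Fin.cases ?_ (fun i => ?_) i) i
    · have := key 0 (by simpa using (congrArg Prod.fst h4).symm)
      rw [abs_le] at this
      have := hv 0
      constructor <;> linarith [this.1, this.2]
    · have := key 1 (by simpa using (congrArg Prod.snd h4).symm)
      rw [abs_le] at this
      have := hv 1
      constructor <;> simp only [Fin.succ_zero_eq_one] <;> linarith [this.1, this.2]
    · exact hz i
  refine ⟨fun i => ?_, fun i => ?_, fun i => ?_⟩
  · have := hv i
    have := abs_le.mp (hx i)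
    constructor <;> linarith [(hv i).1, (hv i).2]
  · constructor <;> linarith [(hz' i).1, (hz' i).2]
  · have := abs_le.mp (hw i)
    constructor <;> linarith [(hz' i).1, (hz' i).2]

lemma restCoord_mem_of_mem_unitCube {m : ℕ} {z : EuclideanSpace ℝ (Fin (m + 2))}
    (hz : z ∈ unitCube (m + 2)) : restCoord m z ∈ axisBox m 0 1 := fun i => hz i.succ.succ

lemma lintegral_crossingTriples_le (m : ℕ) (r : ℝ) (v : EuclideanSpace ℝ (Fin (m + 2))) :
    ∫⁻ x in unitCube (m + 2), ∫⁻ z in unitCube (m + 2), ∫⁻ w in unitCube (m + 2),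
      (crossingTriples m r v).indicator (fun _ => (1 : ℝ≥0∞)) (x, z, w) ≤ crossIntegral m r := by
  have h := lintegral_slab m r v (measurableSet_axisBox m 0 1)
  rw [volume_axisBox, sub_zero, ENNReal.ofReal_one, one_pow, one_mul] at h
  rw [← h]
  refine (setLIntegral_le_lintegral _ _).trans (lintegral_mono fun x => ?_)
  refine (lintegral_mono_set fun z hz => restCoord_mem_of_mem_unitCube hz).trans
    (lintegral_mono fun z => setLIntegral_le_lintegral _ _)

lemma le_lintegral_crossingTriples (m : ℕ) (r : ℝ) {v : EuclideanSpace ℝ (Fin (m + 2))}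
    (hv : v ∈ axisBox (m + 2) (4 * r) (1 - 4 * r)) :
    ENNReal.ofReal (1 - 2 * r) ^ m * crossIntegral m r ≤
    ∫⁻ x in unitCube (m + 2), ∫⁻ z in unitCube (m + 2), ∫⁻ w in unitCube (m + 2),
      (crossingTriples m r v).indicator (fun _ => (1 : ℝ≥0∞)) (x, z, w) := by
  have h := lintegral_slab m r v (measurableSet_axisBox m r (1 - r))
  rw [volume_axisBox, show 1 - r - r = 1 - 2 * r by ring] at h
  have hW := measurableSet_unitCube (m + 2)
  have hR : MeasurableSet (restCoord m ⁻¹' axisBox m r (1 - r)) :=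
    measurable_restCoord m (measurableSet_axisBox m r (1 - r))
  rw [← h]
  simp_rw [← lintegral_indicator hW, ← lintegral_indicator hR]
  refine lintegral_mono fun x => ?_
  by_cases hx : x ∈ unitCube (m + 2)
  · rw [Set.indicator_of_mem hx]
    refine lintegral_mono fun z => ?_
    by_cases hz : z ∈ restCoord m ⁻¹' axisBox m r (1 - r)
    · rw [Set.indicator_of_mem hz]
      by_cases hzW : z ∈ unitCube (m + 2)
      · rw [Set.indicator_of_mem hzW]
        refine lintegral_mono fun w => ?_
        by_cases hw : w ∈ unitCube (m + 2)
        · rw [Set.indicator_of_mem hw]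
        · rw [Set.indicator_of_notMem
            fun hc => hw (crossingTriples_subset hv hc hz).2.2]
          exact zero_le
      · refine le_trans (le_of_eq ?_) zero_le
        rw [← lintegral_zero
        (μ := (volume : Measure (EuclideanSpace ℝ (Fin (m + 2)))))]
        refine lintegral_congr fun w => ?_
        exact Set.indicator_of_notMem
          (fun hc => hzW (crossingTriples_subset hv hc hz).2.1) _
    · rw [Set.indicator_of_notMem hz]
      exact zero_le
  · refine le_trans (le_of_eq ?_) zero_le
    rw [← lintegral_zero
        (μ := (volume : Measure (EuclideanSpace ℝ (Fin (m + 2)))))]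
    refine lintegral_congr fun z => ?_
    by_cases hz : z ∈ restCoord m ⁻¹' axisBox m r (1 - r)
    · rw [Set.indicator_of_mem hz, ← lintegral_zero
        (μ := (volume : Measure (EuclideanSpace ℝ (Fin (m + 2)))))]
      refine lintegral_congr fun w => ?_
      exact Set.indicator_of_notMem
          (fun hc => hx (crossingTriples_subset hv hc hz).1) _
    · exact Set.indicator_of_notMem hz _

/-- The intensity measure. -/
noncomputable def cubeIntensity (n : ℕ) (t : ℝ) : Measure (EuclideanSpace ℝ (Fin n)) :=
  ENNReal.ofReal t • volume.restrict (unitCube n)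

instance (n : ℕ) (t : ℝ) : IsFiniteMeasure (cubeIntensity n t) :=
  Measure.smul_finite _ ENNReal.ofReal_ne_top

instance (m : ℕ) (t : ℝ) : NullSingletonClass (cubeIntensity (m + 2) t) :=
  ⟨fun x => by simp [cubeIntensity]⟩

lemma lintegral_cubeIntensity (n : ℕ) (t : ℝ) (f : EuclideanSpace ℝ (Fin n) → ℝ≥0∞) :
    ∫⁻ x, f x ∂(cubeIntensity n t) = ENNReal.ofReal t * ∫⁻ x in unitCube n, f x := by
  rw [cubeIntensity, lintegral_smul_measure, smul_eq_mul]

lemma pi_cubeIntensity_crossingSet (m : ℕ) (t r : ℝ) (v : EuclideanSpace ℝ (Fin (m + 2))) :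
    Measure.pi (fun _ : Fin 3 => cubeIntensity (m + 2) t)
        {y | (Fin.cons v y : Fin 4 → EuclideanSpace ℝ (Fin (m + 2))) ∈ crossingSet m r} =
      ENNReal.ofReal t ^ 3 * ∫⁻ x in unitCube (m + 2), ∫⁻ z in unitCube (m + 2),
        ∫⁻ w in unitCube (m + 2),
        (crossingTriples m r v).indicator (fun _ => (1 : ℝ≥0∞)) (x, z, w) := by
  have hcons : ∀ {n : ℕ} (a : EuclideanSpace ℝ (Fin (m + 2))),
      Measurable fun y : Fin n → EuclideanSpace ℝ (Fin (m + 2)) =>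
        (Fin.cons a y : Fin (n + 1) → EuclideanSpace ℝ (Fin (m + 2))) := fun a =>
    (measurableEmbedding_cons _).measurable.comp measurable_prodMk_left
  have hS : MeasurableSet {y : Fin 3 → EuclideanSpace ℝ (Fin (m + 2)) |
      (Fin.cons v y : Fin 4 → EuclideanSpace ℝ (Fin (m + 2))) ∈ crossingSet m r} :=
    hcons v (measurableSet_crossingSet m r)
  let G : (Fin 3 → EuclideanSpace ℝ (Fin (m + 2))) → ℝ≥0∞ :=
    {y : Fin 3 → EuclideanSpace ℝ (Fin (m + 2)) |
      (Fin.cons v y : Fin 4 → EuclideanSpace ℝ (Fin (m + 2))) ∈ crossingSet m r}.indicator 1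
  have hG : Measurable G := measurable_one.indicator hS
  have h2 : ∀ a, ∫⁻ y, G (Fin.cons a y) ∂(Measure.pi fun _ => cubeIntensity (m + 2) t) =
      ∫⁻ b, ∫⁻ y, G (Fin.cons a (Fin.cons b y)) ∂(Measure.pi fun _ => cubeIntensity (m + 2) t)
        ∂(cubeIntensity (m + 2) t) := fun a =>
    lintegral_pi_succ 1 (fun y => G (Fin.cons a y)) (hG.comp (hcons a))
  have h1 : ∀ a b, ∫⁻ y, G (Fin.cons a (Fin.cons b y))
        ∂(Measure.pi fun _ => cubeIntensity (m + 2) t) =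
      ∫⁻ c, ∫⁻ y, G (Fin.cons a (Fin.cons b (Fin.cons c y)))
        ∂(Measure.pi fun _ => cubeIntensity (m + 2) t) ∂(cubeIntensity (m + 2) t) := fun a b =>
    lintegral_pi_succ 0 (fun y => G (Fin.cons a (Fin.cons b y)))
      ((hG.comp (hcons a)).comp (hcons b))
  rw [← lintegral_indicator_one hS, lintegral_pi_succ 2 _ hG]
  simp_rw [h2, h1]
  have h0 : ∀ F : (Fin 0 → EuclideanSpace ℝ (Fin (m + 2))) → ℝ≥0∞,
      ∫⁻ y, F y ∂(Measure.pi fun _ : Fin 0 => cubeIntensity (m + 2) t) = F Fin.elim0 := by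
    intro F
    rw [Measure.pi_of_empty _ Fin.elim0, lintegral_dirac]
  simp_rw [h0, lintegral_cubeIntensity, lintegral_const_mul' _ _ (ENNReal.ofReal_ne_top (r := t)),
    pow_succ, pow_zero, one_mul, mul_assoc]
  rfl

lemma crossIntegral_ne_top (m : ℕ) {r : ℝ} (hr : 0 < r) : crossIntegral m r ≠ ∞ := by
  rw [crossIntegral_eq_mul m hr, crossIntegral_one]
  finiteness

lemma crossIntegral_toReal (m : ℕ) {r : ℝ} (hr : 0 < r) :
    (crossIntegral m r).toReal = r ^ (2 * m + 6) * crossingConst (m + 2) := by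
  rw [crossIntegral_eq_mul m hr, ENNReal.toReal_mul, ENNReal.toReal_ofReal (by positivity),
    crossingConst_eq_crossIntegral]

theorem crossingConst_eq (m : ℕ) : crossingConst (m + 2) =
    2 * Real.pi * unitBallVolume m ^ 2 * beta (3 / 2) (((m + 2 : ℕ) : ℝ) / 2) ^ 2 := by
  rw [crossingConst_eq_crossIntegral, crossIntegral_one, ENNReal.toReal_ofReal]
  have : 0 ≤ unitBallVolume m := measureReal_nonneg
  positivity

lemma crossingConst_pos (m : ℕ) : 0 < crossingConst (m + 2) := by
  rw [crossingConst_eq]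
  have h1 : 0 < unitBallVolume m :=
    ENNReal.toReal_pos (Metric.measure_closedBall_pos _ _ one_pos).ne'
      measure_closedBall_lt_top.ne
  have h2 : 0 < beta (3 / 2) (((m + 2 : ℕ) : ℝ) / 2) := beta_pos (by norm_num) (by positivity)
  positivity

/-- The expected number of crossings of edges at `v`. -/
noncomputable def crossingIntensity (m : ℕ) (t r : ℝ) (v : EuclideanSpace ℝ (Fin (m + 2))) : ℝ :=
  (Measure.pi fun _ : Fin 3 => cubeIntensity (m + 2) t).real
    {y | (Fin.cons v y : Fin 4 → EuclideanSpace ℝ (Fin (m + 2))) ∈ crossingSet m r}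

lemma crossingIntensity_le (m : ℕ) {t r : ℝ} (ht : 0 < t) (hr : 0 < r)
    (v : EuclideanSpace ℝ (Fin (m + 2))) :
    crossingIntensity m t r v ≤ t ^ 3 * (r ^ (2 * m + 6) * crossingConst (m + 2)) := by
  rw [crossingIntensity, measureReal_def, pi_cubeIntensity_crossingSet, ENNReal.toReal_mul,
    ENNReal.toReal_pow, ENNReal.toReal_ofReal ht.le, ← crossIntegral_toReal m hr]
  gcongr
  · exact crossIntegral_ne_top m hr
  · exact lintegral_crossingTriples_le m r v

lemma le_crossingIntensity (m : ℕ) {t r : ℝ} (ht : 0 < t) (hr : 0 < r) (hr2 : 2 * r ≤ 1)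
    {v : EuclideanSpace ℝ (Fin (m + 2))} (hv : v ∈ axisBox (m + 2) (4 * r) (1 - 4 * r)) :
    t ^ 3 * ((1 - 2 * r) ^ m * (r ^ (2 * m + 6) * crossingConst (m + 2))) ≤
      crossingIntensity m t r v := by
  rw [crossingIntensity, measureReal_def, pi_cubeIntensity_crossingSet, ENNReal.toReal_mul,
    ENNReal.toReal_pow, ENNReal.toReal_ofReal ht.le, ← crossIntegral_toReal m hr]
  have h := ENNReal.toReal_mono (ne_top_of_le_ne_top (crossIntegral_ne_top m hr)
    (lintegral_crossingTriples_le m r v)) (le_lintegral_crossingTriples m r hv)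
  rw [ENNReal.toReal_mul, ENNReal.toReal_pow, ENNReal.toReal_ofReal (by linarith)] at h
  gcongr

end CrossingBounds

section CovarianceBounds
open scoped ENNReal

lemma measurePreserving_comp_perm {X : Type*} [MeasurableSpace X] {Λ : Measure X}
    [IsFiniteMeasure Λ] {k : ℕ} (σ : Equiv.Perm (Fin k)) :
    MeasurePreserving (fun x : Fin k → X => x ∘ σ) (Measure.pi fun _ => Λ)
      (Measure.pi fun _ => Λ) := by
  have hm : Measurable fun x : Fin k → X => x ∘ σ :=
    measurable_pi_lambda _ fun i => measurable_pi_apply _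
  refine ⟨hm, (Measure.pi_eq fun A hA => ?_).symm⟩
  rw [Measure.map_apply hm (.univ_pi hA)]
  have : (fun x : Fin k → X => x ∘ σ) ⁻¹' Set.univ.pi A = Set.univ.pi fun i => A (σ.symm i) := by
    ext x
    simp only [Set.mem_preimage, Set.mem_univ_pi, Function.comp_apply]
    exact ⟨fun h i => by simpa using h (σ.symm i), fun h i => by simpa using h (σ i)⟩
  rw [this, Measure.pi_pi]
  exact Equiv.prod_comp σ.symm fun i => Λ (A i)

lemma mem_crossingSet_iff {m : ℕ} {r : ℝ} {x : Fin 4 → EuclideanSpace ℝ (Fin (m + 2))} :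
    x ∈ crossingSet m r ↔ ‖x 0 - x 1‖ ≤ r ∧ ‖x 2 - x 3‖ ≤ r ∧
      ((planeProj (m + 2) '' segment ℝ (x 0) (x 1)) ∩
        (planeProj (m + 2) '' segment ℝ (x 2) (x 3))).Nonempty := by
  rw [planeProj_segment_inter_nonempty]
  rfl

lemma exists_perm_crossingSet (i : Fin 4) : ∃ σ : Equiv.Perm (Fin 4), σ 0 = i ∧
    ∀ (m : ℕ) (r : ℝ) (x : Fin 4 → EuclideanSpace ℝ (Fin (m + 2))),
      x ∘ σ ∈ crossingSet m r ↔ x ∈ crossingSet m r := by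
  fin_cases i
  · exact ⟨1, rfl, fun m r x => Iff.rfl⟩
  · refine ⟨Equiv.swap 0 1, rfl, fun m r x => ?_⟩
    have h0 : Equiv.swap (0 : Fin 4) 1 0 = 1 := by decide
    have h1 : Equiv.swap (0 : Fin 4) 1 1 = 0 := by decide
    have h2 : Equiv.swap (0 : Fin 4) 1 2 = 2 := by decide
    have h3 : Equiv.swap (0 : Fin 4) 1 3 = 3 := by decide
    rw [mem_crossingSet_iff, mem_crossingSet_iff]
    simp only [Function.comp_apply, h0, h1, h2, h3]
    rw [norm_sub_rev, segment_symm ℝ (x 1)]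
  · refine ⟨Equiv.swap 0 2 * Equiv.swap 1 3, by decide, fun m r x => ?_⟩
    have h0 : (Equiv.swap (0 : Fin 4) 2 * Equiv.swap 1 3 : Equiv.Perm (Fin 4)) 0 = 2 := by decide
    have h1 : (Equiv.swap (0 : Fin 4) 2 * Equiv.swap 1 3 : Equiv.Perm (Fin 4)) 1 = 3 := by decide
    have h2 : (Equiv.swap (0 : Fin 4) 2 * Equiv.swap 1 3 : Equiv.Perm (Fin 4)) 2 = 0 := by decide
    have h3 : (Equiv.swap (0 : Fin 4) 2 * Equiv.swap 1 3 : Equiv.Perm (Fin 4)) 3 = 1 := by decide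
    rw [mem_crossingSet_iff, mem_crossingSet_iff]
    simp only [Function.comp_apply, h0, h1, h2, h3]
    rw [Set.inter_comm]
    tauto
  · refine ⟨Equiv.swap 0 3 * Equiv.swap 1 2, by decide, fun m r x => ?_⟩
    have h0 : (Equiv.swap (0 : Fin 4) 3 * Equiv.swap 1 2 : Equiv.Perm (Fin 4)) 0 = 3 := by decide
    have h1 : (Equiv.swap (0 : Fin 4) 3 * Equiv.swap 1 2 : Equiv.Perm (Fin 4)) 1 = 2 := by decide
    have h2 : (Equiv.swap (0 : Fin 4) 3 * Equiv.swap 1 2 : Equiv.Perm (Fin 4)) 2 = 1 := by decide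
    have h3 : (Equiv.swap (0 : Fin 4) 3 * Equiv.swap 1 2 : Equiv.Perm (Fin 4)) 3 = 0 := by decide
    rw [mem_crossingSet_iff, mem_crossingSet_iff]
    simp only [Function.comp_apply, h0, h1, h2, h3]
    rw [norm_sub_rev (x 3), norm_sub_rev (x 1), segment_symm ℝ (x 3), segment_symm ℝ (x 1),
      Set.inter_comm]
    tauto

lemma integral_cubeIntensity (n : ℕ) {t : ℝ} (ht : 0 ≤ t) (f : EuclideanSpace ℝ (Fin n) → ℝ) :
    ∫ x, f x ∂(cubeIntensity n t) = t * ∫ x in unitCube n, f x := by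
  rw [cubeIntensity, integral_smul_measure, ENNReal.toReal_ofReal ht, smul_eq_mul]

lemma cubeIntensity_compl (n : ℕ) (t : ℝ) : cubeIntensity n t (unitCube n)ᶜ = 0 := by
  simp [cubeIntensity, Measure.restrict_apply (measurableSet_unitCube n).compl]

lemma cubeIntensity_real_univ (n : ℕ) {t : ℝ} (ht : 0 ≤ t) :
    (cubeIntensity n t).real Set.univ = t := by
  simp [cubeIntensity, measureReal_def, ht]

lemma measurable_crossingIntensity (m : ℕ) (t r : ℝ) : Measurable (crossingIntensity m t r) := by
  have h : MeasurableSet {p : EuclideanSpace ℝ (Fin (m + 2)) ×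
      (Fin 3 → EuclideanSpace ℝ (Fin (m + 2))) |
      (Fin.cons p.1 p.2 : Fin 4 → EuclideanSpace ℝ (Fin (m + 2))) ∈ crossingSet m r} :=
    (measurableEmbedding_cons 3).measurable (measurableSet_crossingSet m r)
  exact (measurable_measure_prodMk_left
    (ν := Measure.pi fun _ : Fin 3 => cubeIntensity (m + 2) t) h).ennreal_toReal

lemma crossingIntensity_nonneg (m : ℕ) (t r : ℝ) (v : EuclideanSpace ℝ (Fin (m + 2))) :
    0 ≤ crossingIntensity m t r v := measureReal_nonneg

lemma measurable_indicator_crossingSet (m : ℕ) (r : ℝ) :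
    Measurable ((crossingSet m r).indicator fun _ => (1 : ℝ)) :=
  measurable_const.indicator (measurableSet_crossingSet m r)

lemma abs_indicator_one_le {X : Type*} (S : Set X) (x : X) :
    |S.indicator (fun _ => (1 : ℝ)) x| ≤ 1 := by
  by_cases h : x ∈ S <;> simp [h]

lemma integral_crossingSet_mul_apply_zero (m : ℕ) (t r : ℝ)
    {h : EuclideanSpace ℝ (Fin (m + 2)) → ℝ} (hh : Measurable h) {C : ℝ} (hC : ∀ v, |h v| ≤ C) :
    ∫ x, (crossingSet m r).indicator (fun _ => (1 : ℝ)) x * h (x 0)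
        ∂(Measure.pi fun _ : Fin 4 => cubeIntensity (m + 2) t) =
      ∫ v, crossingIntensity m t r v * h v ∂(cubeIntensity (m + 2) t) := by
  have hm := ((measurable_indicator_crossingSet m r).comp
    (measurableEmbedding_cons (X := EuclideanSpace ℝ (Fin (m + 2))) 3).measurable)
  rw [integral_pi_succ 3, integral_prod]
  · refine integral_congr_ae (ae_of_all _ fun v => ?_)
    simp only [Fin.cons_zero]
    rw [integral_mul_const]
    congr 1
    have hS : MeasurableSet {y : Fin 3 → EuclideanSpace ℝ (Fin (m + 2)) |
        (Fin.cons v y : Fin 4 → EuclideanSpace ℝ (Fin (m + 2))) ∈ crossingSet m r} :=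
      (measurableEmbedding_cons 3).measurable.comp measurable_prodMk_left
        (measurableSet_crossingSet m r)
    exact integral_indicator_one hS
  · refine integrable_of_bounded (C := 1 * C) (hm.mul (hh.comp measurable_fst)) fun p => ?_
    rw [abs_mul]
    exact mul_le_mul (abs_indicator_one_le _ _) (hC _) (abs_nonneg _) zero_le_one

lemma integral_crossingSet_mul_apply (m : ℕ) (t r : ℝ)
    {h : EuclideanSpace ℝ (Fin (m + 2)) → ℝ} (hh : Measurable h) {C : ℝ} (hC : ∀ v, |h v| ≤ C)
    (i : Fin 4) :
    ∫ x, (crossingSet m r).indicator (fun _ => (1 : ℝ)) x * h (x i)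
        ∂(Measure.pi fun _ : Fin 4 => cubeIntensity (m + 2) t) =
      ∫ v, crossingIntensity m t r v * h v ∂(cubeIntensity (m + 2) t) := by
  obtain ⟨σ, hσ0, hσ⟩ := exists_perm_crossingSet i
  have hmp := measurePreserving_comp_perm (Λ := cubeIntensity (m + 2) t) σ
  have hm : Measurable fun x : Fin 4 → EuclideanSpace ℝ (Fin (m + 2)) =>
      (crossingSet m r).indicator (fun _ => (1 : ℝ)) x * h (x 0) :=
    (measurable_indicator_crossingSet m r).mul (hh.comp (measurable_pi_apply 0))
  rw [← integral_crossingSet_mul_apply_zero m t r hh hC]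
  nth_rewrite 2 [← hmp.map_eq]
  rw [integral_map hmp.aemeasurable hm.aestronglyMeasurable]
  refine integral_congr_ae (ae_of_all _ fun x => ?_)
  simp only [Function.comp_apply, hσ0]
  congr 1
  by_cases hx : x ∈ crossingSet m r
  · rw [Set.indicator_of_mem hx, Set.indicator_of_mem ((hσ m r x).mpr hx)]
  · rw [Set.indicator_of_notMem hx, Set.indicator_of_notMem fun h => hx ((hσ m r x).mp h)]

variable {m : ℕ} {g : EuclideanSpace ℝ (Fin (m + 2)) → EuclideanSpace ℝ (Fin (m + 2)) → ℝ}

/-- The symmetrized integral of a function of two points. -/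
noncomputable def symmIntegral (t : ℝ)
    (g : EuclideanSpace ℝ (Fin (m + 2)) → EuclideanSpace ℝ (Fin (m + 2)) → ℝ)
    (v : EuclideanSpace ℝ (Fin (m + 2))) : ℝ :=
  ∫ a, (g a v + g v a) ∂(cubeIntensity (m + 2) t)

lemma measurable_symmIntegral (t : ℝ) (hg : Measurable (Function.uncurry g)) :
    Measurable (symmIntegral t g) := by
  have : StronglyMeasurable fun p : EuclideanSpace ℝ (Fin (m + 2)) ×
      EuclideanSpace ℝ (Fin (m + 2)) => g p.2 p.1 + g p.1 p.2 :=
    ((hg.comp measurable_swap).add hg).stronglyMeasurable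
  exact this.integral_prod_right'.measurable

lemma symmIntegral_nonneg (t : ℝ) (hg0 : ∀ a b, 0 ≤ g a b) (v : EuclideanSpace ℝ (Fin (m + 2))) :
    0 ≤ symmIntegral t g v :=
  integral_nonneg fun _ => add_nonneg (hg0 _ _) (hg0 _ _)

lemma symmIntegral_le {t : ℝ} (ht : 0 ≤ t) {s : ℝ} (hg0 : ∀ a b, 0 ≤ g a b)
    (hgs : ∀ a b, g a b ≤ s) (v : EuclideanSpace ℝ (Fin (m + 2))) :
    symmIntegral t g v ≤ 2 * s * t := by
  have h : symmIntegral t g v ≤ ∫ _, 2 * s ∂(cubeIntensity (m + 2) t) := by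
    refine integral_mono_of_nonneg (ae_of_all _ fun _ => add_nonneg (hg0 _ _) (hg0 _ _))
      (integrable_const _) (ae_of_all _ fun a => ?_)
    linarith [hgs a v, hgs v a]
  rw [integral_const, cubeIntensity_real_univ _ ht, smul_eq_mul] at h
  linarith

lemma integral_symmIntegral {t : ℝ} (ht : 0 ≤ t) {s : ℝ} (hg : Measurable (Function.uncurry g))
    (hgs : ∀ a b, |g a b| ≤ s) :
    ∫ v, symmIntegral t g v ∂(cubeIntensity (m + 2) t) =
      2 * t ^ 2 * ∫ v in unitCube (m + 2), ∫ y in unitCube (m + 2), g v y := by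
  have hi : Integrable (Function.uncurry g)
      ((cubeIntensity (m + 2) t).prod (cubeIntensity (m + 2) t)) :=
    integrable_of_bounded hg fun p => hgs _ _
  have hi' : Integrable (fun p => g p.2 p.1)
      ((cubeIntensity (m + 2) t).prod (cubeIntensity (m + 2) t)) := hi.swap
  have hadd : ∀ v, symmIntegral t g v =
      (∫ a, g a v ∂(cubeIntensity (m + 2) t)) + ∫ a, g v a ∂(cubeIntensity (m + 2) t) := fun v =>
    integral_add (integrable_of_bounded (hg.comp measurable_prodMk_right) fun a => hgs _ _)
      (integrable_of_bounded (hg.comp measurable_prodMk_left) fun a => hgs _ _)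
  simp_rw [hadd]
  rw [integral_add (f := fun v => ∫ a, g a v ∂(cubeIntensity (m + 2) t))
      (g := fun v => ∫ a, g v a ∂(cubeIntensity (m + 2) t))
      hi'.integral_prod_left hi.integral_prod_left,
    integral_integral_swap (f := fun v a => g a v) hi']
  simp_rw [integral_cubeIntensity (m + 2) ht]
  rw [integral_const_mul]
  ring

lemma integral_pi_two_cubeIntensity {t : ℝ} (ht : 0 ≤ t) {s : ℝ} (hg : Measurable (Function.uncurry g))
    (hgs : ∀ a b, |g a b| ≤ s) :
    ∫ y, g (y 0) (y 1) ∂(Measure.pi fun _ : Fin 2 => cubeIntensity (m + 2) t) =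
      t ^ 2 * ∫ v in unitCube (m + 2), ∫ y in unitCube (m + 2), g v y := by
  rw [integral_pi_two, integral_prod (fun p => g p.1 p.2)
    (integrable_of_bounded hg fun p => hgs _ _)]
  simp_rw [integral_cubeIntensity (m + 2) ht]
  rw [integral_const_mul]
  ring

lemma cubeIntensity_real_compl_axisBox_le {t r : ℝ} (ht : 0 ≤ t) (hr : 0 ≤ r) (hr8 : 8 * r ≤ 1) :
    (cubeIntensity (m + 2) t).real (axisBox (m + 2) (4 * r) (1 - 4 * r))ᶜ ≤
      t * (8 * (m + 2) * r) := by
  have hsub : axisBox (m + 2) (4 * r) (1 - 4 * r) ⊆ unitCube (m + 2) := fun x hx i =>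
    ⟨by linarith [(hx i).1], by linarith [(hx i).2]⟩
  have h1 : (cubeIntensity (m + 2) t).real (axisBox (m + 2) (4 * r) (1 - 4 * r)) =
      t * (1 - 8 * r) ^ (m + 2) := by
    rw [measureReal_def, cubeIntensity, Measure.smul_apply,
      Measure.restrict_apply (measurableSet_axisBox _ _ _), Set.inter_eq_left.mpr hsub,
      volume_axisBox, smul_eq_mul, ENNReal.toReal_mul, ENNReal.toReal_pow,
      ENNReal.toReal_ofReal ht, ENNReal.toReal_ofReal (by linarith)]
    ring_nf
  rw [measureReal_compl (measurableSet_axisBox _ _ _), h1, cubeIntensity_real_univ _ ht]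
  have h2 := one_add_mul_le_pow (show (-2 : ℝ) ≤ -(8 * r) by linarith) (m + 2)
  push_cast at h2
  rw [← sub_eq_add_neg] at h2
  nlinarith

/-- Upper bound for the main term of the covariance. -/
lemma integral_crossingIntensity_mul_le {t r s : ℝ} (ht : 0 < t) (hr : 0 < r)
    (hg : Measurable (Function.uncurry g)) (hg0 : ∀ a b, 0 ≤ g a b) (hgs : ∀ a b, g a b ≤ s) :
    ∫ v, crossingIntensity m t r v * symmIntegral t g v ∂(cubeIntensity (m + 2) t) ≤
      t ^ 3 * (r ^ (2 * m + 6) * crossingConst (m + 2)) *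
        (2 * t ^ 2 * ∫ v in unitCube (m + 2), ∫ y in unitCube (m + 2), g v y) := by
  have habs : ∀ a b, |g a b| ≤ s := fun a b => by rw [abs_of_nonneg (hg0 a b)]; exact hgs a b
  rw [← integral_symmIntegral ht.le hg habs, ← integral_const_mul]
  refine integral_mono_of_nonneg (ae_of_all _ fun v => mul_nonneg (crossingIntensity_nonneg _ _ _ _)
    (symmIntegral_nonneg t hg0 v)) ?_ (ae_of_all _ fun v => ?_)
  · refine (integrable_of_bounded (C := 2 * s * t) (measurable_symmIntegral t hg)
      fun v => ?_).const_mul _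
    rw [abs_of_nonneg (symmIntegral_nonneg t hg0 v)]
    exact symmIntegral_le ht.le hg0 hgs v
  · exact mul_le_mul_of_nonneg_right (crossingIntensity_le m ht hr v) (symmIntegral_nonneg t hg0 v)

/-- Lower bound for the main term of the covariance. -/
lemma le_integral_crossingIntensity_mul {t r s : ℝ} (ht : 0 < t) (hr : 0 < r) (hr8 : 8 * r ≤ 1)
    (hs : 0 ≤ s)
    (hg : Measurable (Function.uncurry g)) (hg0 : ∀ a b, 0 ≤ g a b) (hgs : ∀ a b, g a b ≤ s) :
    t ^ 3 * (r ^ (2 * m + 6) * crossingConst (m + 2)) * (2 * t ^ 2) *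
        ((1 - 2 * m * r) * (∫ v in unitCube (m + 2), ∫ y in unitCube (m + 2), g v y) -
          8 * (m + 2) * s * r) ≤
    ∫ v, crossingIntensity m t r v * symmIntegral t g v ∂(cubeIntensity (m + 2) t) := by
  have habs : ∀ a b, |g a b| ≤ s := fun a b => by rw [abs_of_nonneg (hg0 a b)]; exact hgs a b
  set I := ∫ v in unitCube (m + 2), ∫ y in unitCube (m + 2), g v y with hI
  have hI0 : 0 ≤ I := integral_nonneg fun v => integral_nonneg fun y => hg0 _ _
  set B := t ^ 3 * (r ^ (2 * m + 6) * crossingConst (m + 2)) with hB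
  have hBpos : 0 < B := by have := crossingConst_pos m; positivity
  set S := (axisBox (m + 2) (4 * r) (1 - 4 * r))ᶜ with hS
  have hSm : MeasurableSet S := (measurableSet_axisBox _ _ _).compl
  have hq0 : 0 ≤ (1 - 2 * r) ^ m := pow_nonneg (by linarith) _
  have hq1 : (1 - 2 * r) ^ m ≤ 1 := pow_le_one₀ (by linarith) (by linarith)
  have hq2 : 1 - 2 * m * r ≤ (1 - 2 * r) ^ m := by
    have h := one_add_mul_le_pow (show (-2 : ℝ) ≤ -(2 * r) by linarith) m
    rw [← sub_eq_add_neg] at h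
    linarith
  have hHi : Integrable (symmIntegral t g) (cubeIntensity (m + 2) t) :=
    integrable_of_bounded (C := 2 * s * t) (measurable_symmIntegral t hg) fun v => by
      rw [abs_of_nonneg (symmIntegral_nonneg t hg0 v)]
      exact symmIntegral_le ht.le hg0 hgs v
  have hSi : Integrable (S.indicator fun _ => 2 * s * t) (cubeIntensity (m + 2) t) :=
    (integrable_const _).indicator hSm
  have hprod : Integrable (fun v => crossingIntensity m t r v * symmIntegral t g v)
      (cubeIntensity (m + 2) t) := by
    refine integrable_of_bounded (C := B * (2 * s * t))
      ((measurable_crossingIntensity m t r).mul (measurable_symmIntegral t hg)) fun v => ?_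
    rw [abs_of_nonneg (mul_nonneg (crossingIntensity_nonneg _ _ _ _)
      (symmIntegral_nonneg t hg0 v))]
    exact mul_le_mul (crossingIntensity_le m ht hr v) (symmIntegral_le ht.le hg0 hgs v)
      (symmIntegral_nonneg t hg0 v) hBpos.le
  have hle : ∫ v, B * (1 - 2 * r) ^ m * (symmIntegral t g v - S.indicator (fun _ => 2 * s * t) v)
      ∂(cubeIntensity (m + 2) t) ≤
      ∫ v, crossingIntensity m t r v * symmIntegral t g v ∂(cubeIntensity (m + 2) t) := by
    refine integral_mono ((hHi.sub hSi).const_mul _) hprod fun v => ?_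
    by_cases hv : v ∈ S
    · simp only [Set.indicator_of_mem hv]
      refine le_trans ?_ (mul_nonneg (crossingIntensity_nonneg _ _ _ _)
        (symmIntegral_nonneg t hg0 v))
      exact mul_nonpos_of_nonneg_of_nonpos (by positivity)
        (sub_nonpos.mpr (symmIntegral_le ht.le hg0 hgs v))
    · simp only [Set.indicator_of_notMem hv, sub_zero]
      refine mul_le_mul_of_nonneg_right ?_ (symmIntegral_nonneg t hg0 v)
      refine le_trans (le_of_eq ?_) (le_crossingIntensity m ht hr (by linarith)
        (Set.notMem_compl_iff.mp hv))
      rw [hB]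
      ring
  refine le_trans ?_ hle
  rw [integral_const_mul, integral_sub hHi hSi, integral_symmIntegral ht.le hg habs,
    integral_indicator hSm, setIntegral_const, smul_eq_mul, ← hI]
  have h3 := cubeIntensity_real_compl_axisBox_le (m := m) ht.le hr.le hr8
  rw [← hS] at h3
  have h4 : (cubeIntensity (m + 2) t).real S * (2 * s * t) ≤ 2 * t ^ 2 * (8 * (m + 2) * s * r) := by
    calc _ ≤ t * (8 * (m + 2) * r) * (2 * s * t) := by gcongr
      _ = _ := by ring
  have h5 : (1 - 2 * m * r) * I - 8 * (m + 2) * s * r ≤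
      (1 - 2 * r) ^ m * (I - 8 * (m + 2) * s * r) := by
    have h6 : 0 ≤ 8 * (m + 2) * s * r := by positivity
    nlinarith [mul_le_mul_of_nonneg_right hq2 hI0, mul_le_mul_of_nonneg_right hq1 h6]
  calc B * (2 * t ^ 2) * ((1 - 2 * m * r) * I - 8 * (m + 2) * s * r)
      ≤ B * (2 * t ^ 2) * ((1 - 2 * r) ^ m * (I - 8 * (m + 2) * s * r)) := by gcongr
    _ = B * (1 - 2 * r) ^ m * (2 * t ^ 2 * I - 2 * t ^ 2 * (8 * (m + 2) * s * r)) := by ring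
    _ ≤ _ := by gcongr

end CovarianceBounds

section Asymptotic
open scoped ENNReal

lemma covariance_congr_ae {Ω : Type*} [MeasurableSpace Ω] {P : Measure Ω} {X X' Y Y' : Ω → ℝ}
    (hX : X =ᵐ[P] X') (hY : Y =ᵐ[P] Y') : covariance X Y P = covariance X' Y' P := by
  rw [covariance, covariance, integral_congr_ae hX, integral_congr_ae hY]
  refine integral_congr_ae ?_
  filter_upwards [hX, hY] with ω h1 h2
  rw [h1, h2]

variable {m : ℕ} {Ω : Type*} [MeasurableSpace Ω] {P : Measure Ω} [IsProbabilityMeasure P]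

lemma covariance_bounds {t r s : ℝ} (ht : 0 < t) (hr : 0 < r) (hs : 0 ≤ s)
    {V : Ω → Finset (EuclideanSpace ℝ (Fin (m + 2)))}
    (hV : IsPoissonProcess P (cubeIntensity (m + 2) t) V)
    {g : EuclideanSpace ℝ (Fin (m + 2)) → EuclideanSpace ℝ (Fin (m + 2)) → ℝ}
    (hg : Measurable (Function.uncurry g)) (hg0 : ∀ a b, 0 ≤ g a b) (hgs : ∀ a b, g a b ≤ s) :
    let K := covariance (fun ω => sumDistinct 4 ((crossingSet m r).indicator fun _ => 1) (V ω))
      (fun ω => sumDistinct 2 (fun y => g (y 0) (y 1)) (V ω)) P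
    let I := ∫ v in unitCube (m + 2), ∫ y in unitCube (m + 2), g v y
    let A := t ^ 5 * (r ^ (2 * m + 6) * crossingConst (m + 2))
    K ≤ 8 * A * I + 16 * s * (A / t) ∧
    (8 * r ≤ 1 → 8 * A * ((1 - 2 * m * r) * I - 8 * (m + 2) * s * r) ≤ K) := by
  intro K I A
  have habs : ∀ a b, |g a b| ≤ s := fun a b => by rw [abs_of_nonneg (hg0 a b)]; exact hgs a b
  have hHm := measurable_symmIntegral t hg
  have hHb : ∀ v, |symmIntegral t g v| ≤ 2 * s * t := fun v => by
    rw [abs_of_nonneg (symmIntegral_nonneg t hg0 v)]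
    exact symmIntegral_le ht.le hg0 hgs v
  have hf0 : ∀ x, 0 ≤ (crossingSet m r).indicator (fun _ => (1 : ℝ)) x :=
    Set.indicator_nonneg fun _ _ => zero_le_one
  have hsum0 : ∀ x : Fin 4 → EuclideanSpace ℝ (Fin (m + 2)),
      0 ≤ ∑ i, ∑ j, (if i = j then 0 else g (x i) (x j)) := fun x =>
    Finset.sum_nonneg fun i _ => Finset.sum_nonneg fun j _ => by
      split_ifs
      · exact le_rfl
      · exact hg0 _ _
  have hsum16 : ∀ x : Fin 4 → EuclideanSpace ℝ (Fin (m + 2)),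
      ∑ i, ∑ j, (if i = j then 0 else g (x i) (x j)) ≤ 16 * s := fun x => by
    calc ∑ i, ∑ j, (if i = j then 0 else g (x i) (x j)) ≤ ∑ _i : Fin 4, ∑ _j : Fin 4, s := by
          refine Finset.sum_le_sum fun i _ => Finset.sum_le_sum fun j _ => ?_
          split_ifs
          · exact hs
          · exact hgs _ _
      _ = 16 * s := by
        simp only [Finset.sum_const, Finset.card_univ, Fintype.card_fin, nsmul_eq_mul]
        push_cast
        ring
  have hK : K = 4 * (∫ v, crossingIntensity m t r v * symmIntegral t g v
      ∂(cubeIntensity (m + 2) t)) +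
      ∫ x, (crossingSet m r).indicator (fun _ => (1 : ℝ)) x *
        ∑ i, ∑ j, (if i = j then 0 else g (x i) (x j))
        ∂(Measure.pi fun _ : Fin 4 => cubeIntensity (m + 2) t) := by
    refine (hV.covariance_sumDistinct 4 (measurable_indicator_crossingSet m r)
      (fun x => abs_indicator_one_le _ x) hg habs zero_le_one hs).trans ?_
    congr 1
    simp_rw [Finset.mul_sum]
    rw [integral_finsetSum]
    · refine (Finset.sum_congr rfl fun i _ =>
        integral_crossingSet_mul_apply m t r hHm hHb i).trans ?_
      simp
    · intro i _
      refine integrable_of_bounded (C := 1 * (2 * s * t))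
        ((measurable_indicator_crossingSet m r).mul (hHm.comp (measurable_pi_apply i)))
        fun x => ?_
      rw [abs_mul]
      exact mul_le_mul (abs_indicator_one_le _ _) (hHb _) (abs_nonneg _) zero_le_one
  have hT0 : 0 ≤ ∫ x, (crossingSet m r).indicator (fun _ => (1 : ℝ)) x *
        ∑ i, ∑ j, (if i = j then 0 else g (x i) (x j))
        ∂(Measure.pi fun _ : Fin 4 => cubeIntensity (m + 2) t) :=
    integral_nonneg fun x => mul_nonneg (hf0 x) (hsum0 x)
  have hT1 : ∫ x, (crossingSet m r).indicator (fun _ => (1 : ℝ)) x *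
        ∑ i, ∑ j, (if i = j then 0 else g (x i) (x j))
        ∂(Measure.pi fun _ : Fin 4 => cubeIntensity (m + 2) t) ≤ 16 * s * (A / t) := by
    calc _ ≤ ∫ x, (crossingSet m r).indicator (fun _ => (1 : ℝ)) x * (16 * s)
          ∂(Measure.pi fun _ : Fin 4 => cubeIntensity (m + 2) t) := by
          refine integral_mono_of_nonneg (ae_of_all _ fun x => mul_nonneg (hf0 x) (hsum0 x)) ?_
            (ae_of_all _ fun x => mul_le_mul_of_nonneg_left (hsum16 x) (hf0 x))
          exact (integrable_of_bounded (measurable_indicator_crossingSet m r)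
            fun x => abs_indicator_one_le _ x).mul_const _
      _ = ∫ v, crossingIntensity m t r v * (16 * s) ∂(cubeIntensity (m + 2) t) :=
          integral_crossingSet_mul_apply_zero m t r (h := fun _ => 16 * s) measurable_const
            fun _ => le_rfl
      _ ≤ ∫ _, t ^ 3 * (r ^ (2 * m + 6) * crossingConst (m + 2)) * (16 * s)
          ∂(cubeIntensity (m + 2) t) := by
          refine integral_mono_of_nonneg (ae_of_all _ fun v =>
            mul_nonneg (crossingIntensity_nonneg _ _ _ _) (by positivity)) (integrable_const _)
            (ae_of_all _ fun v => mul_le_mul_of_nonneg_right (crossingIntensity_le m ht hr v)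
              (by positivity))
      _ = 16 * s * (A / t) := by
          rw [integral_const, cubeIntensity_real_univ _ ht.le, smul_eq_mul]
          simp only [A]
          field_simp
  have hU := integral_crossingIntensity_mul_le (m := m) ht hr hg hg0 hgs
  constructor
  · rw [hK]
    calc _ ≤ 4 * (t ^ 3 * (r ^ (2 * m + 6) * crossingConst (m + 2)) * (2 * t ^ 2 * I)) +
          16 * s * (A / t) := by gcongr
      _ = _ := by simp only [A]; ring
  · intro hr8
    have hL := le_integral_crossingIntensity_mul (m := m) ht hr hr8 hs hg hg0 hgs
    rw [hK]
    calc _ = 4 * (t ^ 3 * (r ^ (2 * m + 6) * crossingConst (m + 2)) * (2 * t ^ 2) *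
        ((1 - 2 * m * r) * I - 8 * (m + 2) * s * r)) := by simp only [A]; ring
      _ ≤ 4 * (∫ v, crossingIntensity m t r v * symmIntegral t g v
          ∂(cubeIntensity (m + 2) t)) := by gcongr
      _ ≤ _ := le_add_of_nonneg_right hT0

variable {w d₀ d₁ : EuclideanSpace ℝ (Fin (m + 2)) → EuclideanSpace ℝ (Fin (m + 2)) → ℝ}

/-- The stress between two points of the cube, and zero outside. -/
noncomputable def cubeStress
    (w d₀ d₁ : EuclideanSpace ℝ (Fin (m + 2)) → EuclideanSpace ℝ (Fin (m + 2)) → ℝ)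
    (x y : EuclideanSpace ℝ (Fin (m + 2))) : ℝ :=
  (unitCube (m + 2) ×ˢ unitCube (m + 2)).indicator
    (Function.uncurry (pairStress w d₀ d₁)) (x, y)

lemma cubeStress_of_mem {x y : EuclideanSpace ℝ (Fin (m + 2))} (hx : x ∈ unitCube (m + 2))
    (hy : y ∈ unitCube (m + 2)) : cubeStress w d₀ d₁ x y = pairStress w d₀ d₁ x y :=
  Set.indicator_of_mem (Set.mk_mem_prod hx hy) _

lemma measurable_cubeStress (hw : Measurable (Function.uncurry w))
    (hd₀ : Measurable (Function.uncurry d₀)) (hd₁ : Measurable (Function.uncurry d₁)) :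
    Measurable (Function.uncurry (cubeStress w d₀ d₁)) := by
  have h : Measurable (Function.uncurry (pairStress w d₀ d₁)) := hw.mul ((hd₀.sub hd₁).pow_const 2)
  exact h.indicator ((measurableSet_unitCube _).prod (measurableSet_unitCube _))

lemma cubeStress_nonneg (hw : ∀ x ∈ unitCube (m + 2), ∀ y ∈ unitCube (m + 2), 0 ≤ w x y)
    (x y : EuclideanSpace ℝ (Fin (m + 2))) : 0 ≤ cubeStress w d₀ d₁ x y := by
  refine Set.indicator_nonneg (fun p hp => ?_) _
  exact mul_nonneg (hw _ hp.1 _ hp.2) (sq_nonneg _)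

lemma cubeStress_le {s : ℝ} (hs : 0 ≤ s)
    (hS : ∀ x ∈ unitCube (m + 2), ∀ y ∈ unitCube (m + 2), pairStress w d₀ d₁ x y < s)
    (x y : EuclideanSpace ℝ (Fin (m + 2))) : cubeStress w d₀ d₁ x y ≤ s :=
  Set.indicator_apply_le' (fun h => (hS _ h.1 _ h.2).le) fun _ => hs

lemma integral_integratedStress :
    ∫ v in unitCube (m + 2), integratedStress (unitCube (m + 2)) w d₀ d₁ v =
      ∫ v in unitCube (m + 2), ∫ y in unitCube (m + 2), cubeStress w d₀ d₁ v y := by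
  refine setIntegral_congr_fun (measurableSet_unitCube _) fun v hv => ?_
  have himg : (fun x => x - v) '' unitCube (m + 2) = (fun u => v + u) ⁻¹' unitCube (m + 2) := by
    ext u
    constructor
    · rintro ⟨x, hx, rfl⟩
      simpa using hx
    · intro hu
      exact ⟨v + u, hu, by simp⟩
  rw [integratedStress, himg, (measurePreserving_add_left volume v).setIntegral_preimage_emb
    (MeasurableEquiv.addLeft v).measurableEmbedding (fun y => pairStress w d₀ d₁ v y)]
  exact setIntegral_congr_fun (measurableSet_unitCube _) fun y hy => (cubeStress_of_mem hv hy).symm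

lemma crossingNumber_eq {r : ℝ} {V : Finset (EuclideanSpace ℝ (Fin (m + 2)))}
    (hV : (V : Set (EuclideanSpace ℝ (Fin (m + 2)))) ⊆ unitCube (m + 2)) :
    crossingNumber (m + 2) r (planeProj (m + 2) '' unitCube (m + 2)) V =
      (1 / 8) * sumDistinct 4 ((crossingSet m r).indicator fun _ => 1) V := by
  rw [crossingNumber]
  congr 1
  refine sumDistinct_congr fun x hx _ => ?_
  have hiff := mem_crossingQuadruples_iff (r := r) fun i => hV (hx i)
  by_cases h : x ∈ crossingSet m r
  · rw [Set.indicator_of_mem h, Set.indicator_of_mem (hiff.mpr h)]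
  · rw [Set.indicator_of_notMem h, Set.indicator_of_notMem fun h' => h (hiff.mp h')]

lemma stress_eq {V : Finset (EuclideanSpace ℝ (Fin (m + 2)))}
    (hV : (V : Set (EuclideanSpace ℝ (Fin (m + 2)))) ⊆ unitCube (m + 2)) :
    stress w d₀ d₁ V =
      (1 / 2) * sumDistinct 2 (fun y => cubeStress w d₀ d₁ (y 0) (y 1)) V := by
  rw [stress]
  congr 1
  exact sumDistinct_congr fun x hx _ => (cubeStress_of_mem (hV (hx 0)) (hV (hx 1))).symm

lemma sumDistinct_nonneg {X : Type*} {k : ℕ} {f : (Fin k → X) → ℝ} (hf : ∀ x, 0 ≤ f x)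
    (V : Finset X) : 0 ≤ sumDistinct k f V := Finset.sum_nonneg fun x _ => hf x

/-- If the relative error is bounded by a multiple of `δ`, it is an `O(δ)` as `t → ∞`. -/
lemma exists_isBigO_of_bounds {δ K M : ℝ → ℝ} {C T : ℝ} (hM : ∀ t, 0 < t → 0 < M t)
    (hδ : ∀ t, 0 < t → 0 < δ t) (hKM : ∀ t, 0 < t → T ≤ t → |K t - M t| ≤ C * δ t * M t) :
    ∃ ε : ℝ → ℝ, ε =O[atTop] δ ∧ ∀ t, 0 < t → K t = M t * (1 + ε t) := by
  refine ⟨fun t => K t / M t - 1, ?_, fun t ht => ?_⟩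
  · refine IsBigO.of_bound C ?_
    filter_upwards [eventually_ge_atTop T, eventually_gt_atTop 0] with t hT ht
    have hMt := hM t ht
    rw [Real.norm_eq_abs, Real.norm_of_nonneg (hδ t ht).le,
      show K t / M t - 1 = (K t - M t) / M t by field_simp, abs_div, abs_of_pos hMt,
      div_le_iff₀ hMt]
    exact hKM t ht hT
  · have := (hM t ht).ne'
    field_simp
    ring

end Asymptotic

theorem mainTheorem7 {d : ℕ} (hd : 3 ≤ d)
    {Ω : Type*} [MeasurableSpace Ω] (P : Measure Ω) [IsProbabilityMeasure P]
    (c : ℝ) (hc : 0 < c)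
    (δ : ℝ → ℝ) (hδ_pos : ∀ t, 0 < t → 0 < δ t) (hδ : ∀ t, 0 < t → t * δ t ^ d = c)
    (V : ℝ → Ω → Finset (EuclideanSpace ℝ (Fin d)))
    (hV : ∀ t, 0 < t →
      IsPoissonProcess P (ENNReal.ofReal t • volume.restrict (unitCube d)) (V t))
    (w d₀ d₁ : EuclideanSpace ℝ (Fin d) → EuclideanSpace ℝ (Fin d) → ℝ)
    (hw_meas : Measurable (Function.uncurry w))
    (hd₀_meas : Measurable (Function.uncurry d₀))
    (hd₁_meas : Measurable (Function.uncurry d₁))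
    (hw_nonneg : ∀ x ∈ unitCube d, ∀ y ∈ unitCube d, 0 ≤ w x y)
    (hS : ∃ s : ℝ, 0 < s ∧ ∀ x ∈ unitCube d, ∀ y ∈ unitCube d, pairStress w d₀ d₁ x y < s) :
    (∀ t, 0 < t →
      MemLp (fun ω => crossingNumber d (δ t) (planeProj d '' unitCube d) (V t ω)) 2 P ∧
      MemLp (fun ω => stress w d₀ d₁ (V t ω)) 2 P) ∧
    (∃ ε : ℝ → ℝ, ε =O[atTop] δ ∧ ∀ t, 0 < t →
      covariance (fun ω => crossingNumber d (δ t) (planeProj d '' unitCube d) (V t ω))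
          (fun ω => stress w d₀ d₁ (V t ω)) P =
        (1 / 2) * crossingConst d * c ^ 2 * t ^ 3 * δ t ^ 2 *
          (∫ v in unitCube d, integratedStress (unitCube d) w d₀ d₁ v) * (1 + ε t)) ∧
    crossingConst d =
      2 * Real.pi * unitBallVolume (d - 2) ^ 2 * beta (3 / 2) ((d : ℝ) / 2) ^ 2 := by
  obtain ⟨m, rfl⟩ : ∃ m, d = m + 2 := ⟨d - 2, by omega⟩
  obtain ⟨s, hs, hS⟩ := hS
  have hg := measurable_cubeStress hw_meas hd₀_meas hd₁_meas
  have hg0 := cubeStress_nonneg (d₀ := d₀) (d₁ := d₁) hw_nonneg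
  have hgs := cubeStress_le hs.le hS
  set g := cubeStress w d₀ d₁ with hg_def
  have habs : ∀ a b, |g a b| ≤ s := fun a b => by rw [abs_of_nonneg (hg0 a b)]; exact hgs a b
  have hV' : ∀ t, 0 < t → IsPoissonProcess P (cubeIntensity (m + 2) t) (V t) := hV
  have hg2 : Measurable fun y : Fin 2 → EuclideanSpace ℝ (Fin (m + 2)) => g (y 0) (y 1) :=
    Measurable.comp (f := fun y : Fin 2 → EuclideanSpace ℝ (Fin (m + 2)) => (y 0, y 1)) hg
      ((measurable_pi_apply 0).prodMk (measurable_pi_apply 1))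
  have hgi : ∀ t, Integrable (fun y : Fin 2 → EuclideanSpace ℝ (Fin (m + 2)) => g (y 0) (y 1))
      (Measure.pi fun _ => cubeIntensity (m + 2) t) := fun t =>
    integrable_of_bounded hg2 fun y => habs _ _
  have hsub : ∀ t, 0 < t → ∀ᵐ ω ∂P,
      (V t ω : Set (EuclideanSpace ℝ (Fin (m + 2)))) ⊆ unitCube (m + 2) := fun t ht =>
    (hV' t ht).ae_subset (measurableSet_unitCube _) (cubeIntensity_compl _ _)
  have hcr : ∀ t, 0 < t → (fun ω => crossingNumber (m + 2) (δ t)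
      (planeProj (m + 2) '' unitCube (m + 2)) (V t ω)) =ᵐ[P]
      fun ω => (1 / 8) * sumDistinct 4 ((crossingSet m (δ t)).indicator fun _ => 1) (V t ω) :=
    fun t ht => (hsub t ht).mono fun ω h => crossingNumber_eq h
  have hst : ∀ t, 0 < t → (fun ω => stress w d₀ d₁ (V t ω)) =ᵐ[P]
      fun ω => (1 / 2) * sumDistinct 2 (fun y => g (y 0) (y 1)) (V t ω) :=
    fun t ht => (hsub t ht).mono fun ω h => stress_eq h
  have hcov : ∀ t, 0 < t → covariance (fun ω => crossingNumber (m + 2) (δ t)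
      (planeProj (m + 2) '' unitCube (m + 2)) (V t ω)) (fun ω => stress w d₀ d₁ (V t ω)) P =
      1 / 16 * covariance
        (fun ω => sumDistinct 4 ((crossingSet m (δ t)).indicator fun _ => 1) (V t ω))
        (fun ω => sumDistinct 2 (fun y => g (y 0) (y 1)) (V t ω)) P := fun t ht => by
    rw [covariance_congr_ae (hcr t ht) (hst t ht), covariance_const_mul_left,
      covariance_const_mul_right]
    ring
  refine ⟨fun t ht => ⟨?_, ?_⟩, ?_, crossingConst_eq m⟩
  · rw [memLp_congr_ae (hcr t ht)]
    exact ((hV' t ht).memLp_sumDistinct .univ (by simp)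
      (integrable_of_bounded (measurable_indicator_crossingSet m (δ t))
        fun x => abs_indicator_one_le _ x) zero_le_one
      fun x _ => abs_indicator_one_le _ x).const_mul _
  · rw [memLp_congr_ae (hst t ht)]
    exact ((hV' t ht).memLp_sumDistinct .univ (by simp) (hgi t) hs.le
      fun x _ => habs _ _).const_mul _
  rw [integral_integratedStress, ← hg_def]
  set I := ∫ v in unitCube (m + 2), ∫ y in unitCube (m + 2), g v y with hI
  have hI0 : 0 ≤ I := integral_nonneg fun v => integral_nonneg fun y => hg0 _ _
  rcases hI0.eq_or_lt with hI0 | hIpos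
  · refine ⟨fun _ => 0, isBigO_zero _ _, fun t ht => ?_⟩
    have hn : 0 ≤ fun ω => sumDistinct 2 (fun y => g (y 0) (y 1)) (V t ω) := fun ω =>
      sumDistinct_nonneg (f := fun y : Fin 2 → EuclideanSpace ℝ (Fin (m + 2)) => g (y 0) (y 1))
        (fun y => hg0 _ _) _
    have hz : (fun ω => sumDistinct 2 (fun y => g (y 0) (y 1)) (V t ω)) =ᵐ[P] 0 := by
      rw [← integral_eq_zero_iff_of_nonneg hn
        ((hV' t ht).integrable_sumDistinct (hgi t)), (hV' t ht).integral_sumDistinct (hgi t),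
        integral_pi_two_cubeIntensity ht.le hg habs, ← hI, ← hI0, mul_zero]
    rw [hcov t ht, covariance_congr_ae (ae_eq_refl _) hz, covariance_zero_right, ← hI0]
    ring
  have hD := crossingConst_pos m
  refine exists_isBigO_of_bounds (C := 2 * m + 8 * (m + 2) * s / I + 2 * s / (c * I))
    (T := c * 8 ^ (m + 2)) (fun t ht => ?_) hδ_pos fun t ht hT => ?_
  · have := hδ_pos t ht
    positivity
  have hδt := hδ_pos t ht
  have hδ8 : 8 * δ t ≤ 1 := by
    have h1 : (8 * δ t) ^ (m + 2) ≤ 1 := by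
      have h2 : t * (8 * δ t) ^ (m + 2) ≤ t * 1 := by
        rw [mul_pow, mul_left_comm, hδ t ht, mul_one, mul_comm]
        exact hT
      exact le_of_mul_le_mul_left h2 ht
    exact (pow_le_one_iff_of_nonneg (by positivity) (by omega)).mp h1
  obtain ⟨hU, hL⟩ := covariance_bounds (m := m) (P := P) ht hδt hs.le (hV' t ht) hg hg0 hgs
  specialize hL hδ8
  rw [hcov t ht]
  set K := covariance
        (fun ω => sumDistinct 4 ((crossingSet m (δ t)).indicator fun _ => 1) (V t ω))
        (fun ω => sumDistinct 2 (fun y => g (y 0) (y 1)) (V t ω)) P with hK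
  rw [← hI] at hU hL
  set A := t ^ 5 * (δ t ^ (2 * m + 6) * crossingConst (m + 2)) with hA
  have hApos : 0 < A := by positivity
  have hM : 1 / 2 * crossingConst (m + 2) * c ^ 2 * t ^ 3 * δ t ^ 2 * I = 1 / 2 * A * I := by
    rw [hA, ← hδ t ht]
    ring
  rw [hM]
  have ht_inv : 1 / t ≤ δ t / c := by
    rw [div_le_div_iff₀ ht hc, one_mul, ← hδ t ht, mul_comm]
    gcongr
    exact pow_le_of_le_one hδt.le (by linarith) (by omega)
  have e : (2 * m + 8 * (m + 2) * s / I + 2 * s / (c * I)) * δ t * (1 / 2 * A * I) =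
      1 / 2 * A * ((2 * m * I + 8 * (m + 2) * s) * δ t) + A * s * (δ t / c) := by
    field_simp
  have h1 : A / t ≤ A * (δ t / c) := by
    rw [div_eq_mul_one_div]
    gcongr
  have h2 : 0 ≤ A * s * (δ t / c) := by positivity
  have h3 : 0 ≤ 1 / 2 * A * ((2 * m * I + 8 * (m + 2) * s) * δ t) := by positivity
  have h4 : s * (A / t) ≤ A * s * (δ t / c) := by
    calc s * (A / t) ≤ s * (A * (δ t / c)) := by gcongr
      _ = _ := by ring
  rw [e, abs_le]
  constructor
  · linarith
  · linarith
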